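/- Let $n\ge 1$ and $R_0\ge 2$. There is a constant $C>0$, depending only on $n$ and $R_0$, such that the following holds. Let $K:\mathbb R^n\setminus\{0\}\to[0,\infty)$ be even ($K(z)=K(-z)$) and twice differentiable, with $$\int_{\mathbb R^n}K(z)\min\{1,|z|\}\,dz<\infty,\qquad K\ge 1\ \text{ in } B_2\setminus\{0\},$$ and suppose that for some constant $C_1$, for all $z\neq 0$ and all unit vectors $e$, $$\max\Big\{|z|\,|\partial_eK(z)|,\ |z|^2\sup_{|y-z|\le |z|/2}|\partial_{ee}K(y)|\Big\}\le K^*(z):=C_1\big(K(z)+\chi_{\{|z|<R_0\}}(z)\big).$$ For measurable $A,B\subset\mathbb R^n$ put $L_K(A,B)=\int_A\int_B K(x-\bar x)\,d\bar x\,dx$, let $P_K(E)=L_K(E,E^c)$, and for an open set $\Omega$ let $$P_{K,\Omega}(E)=L_K(E\cap\Omega,E^c\cap\Omega)+L_K(E\cap\Omega,E^c\setminus\Omega)+L_K(E\setminus\Omega,E^c\cap\Omega).$$ Let $E\subset\mathbb R^n$ be a minimizer of the $K$-perimeter in the ball $B_4=B_4(0)$, that is, $E$ is measurable, $P_{K,B_4}(E)<\infty$,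 and $P_{K,B_4}(E)\le P_{K,B_4}(F)$ for every measurable $F$ with $F\setminus B_4=E\setminus B_4$. Then $P_K(B_4)<\infty$ and the classical perimeter of $E$ in $B_1$, namely $$\mathrm{Per}_{B_1}(E)=|\nabla\chi_E|(B_1)=\sup\Big\{\int_{B_1}\chi_E\,\mathrm{div}\,\phi\,dx:\ \phi\in C^1_c(B_1;\mathbb R^n),\ |\phi|\le 1\Big\},$$ is finite and satisfies $$\mathrm{Per}_{B_1}(E)\le C\sqrt{C_1\,P_K(B_4)}.$$ -/

import Mathlib

open MeasureTheory Metric Set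
open scoped ENNReal

noncomputable section

namespace KPer

/-- Euclidean space `ℝⁿ`. -/
abbrev Space (n : ℕ) : Type := EuclideanSpace ℝ (Fin n)

/-- The interaction `L_K(A, B) = ∫_A ∫_B K(x - y) dy dx`, with values in `[0, ∞]`. -/
def interaction {n : ℕ} (K : Space n → ℝ) (A B : Set (Space n)) : ℝ≥0∞ :=
  ∫⁻ x in A, ∫⁻ y in B, ENNReal.ofReal (K (x - y))

/-- The `K`-perimeter of `E` in the whole space, `P_K(E) = L_K(E, Eᶜ)`. -/
def perimeter {n : ℕ} (K : Space n → ℝ) (E : Set (Space n)) : ℝ≥0∞ :=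
  interaction K E Eᶜ

/-- The `K`-perimeter `P_{K,Ω}(E)` of `E` inside `Ω`. -/
def perimeterIn {n : ℕ} (K : Space n → ℝ) (Ω E : Set (Space n)) : ℝ≥0∞ :=
  interaction K (E ∩ Ω) (Eᶜ ∩ Ω) + interaction K (E ∩ Ω) (Eᶜ \ Ω)
    + interaction K (E \ Ω) (Eᶜ ∩ Ω)

/-- `E` is a minimizer of the `K`-perimeter in `Ω`: it is a (Lebesgue) measurable set of finite
`K`-perimeter in `Ω`, and no measurable set which coincides with `E` outside `Ω` has smaller
`K`-perimeter in `Ω`. -/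
structure IsMinimizer {n : ℕ} (K : Space n → ℝ) (Ω E : Set (Space n)) : Prop where
  measurable : NullMeasurableSet E volume
  finite : perimeterIn K Ω E < ∞
  le : ∀ F : Set (Space n), NullMeasurableSet F volume → F \ Ω = E \ Ω →
    perimeterIn K Ω E ≤ perimeterIn K Ω F

/-- The assumptions on a kernel `K`, with controlling kernel `Kstar`. The kernel matters only
away from the origin (where it may be singular); its value at `0` is not restricted. The last
two fields say that `max {|z| |∂_e K(z)|, |z|² sup_{|y - z| ≤ |z|/2} |∂_{ee} K(y)|} ≤ Kstar(z)`
for all `z ≠ 0` and all unit vectors `e`. -/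
structure IsAdmissible {n : ℕ} (K Kstar : Space n → ℝ) : Prop where
  nonneg : ∀ z, z ≠ 0 → 0 ≤ K z
  even : ∀ z, K z = K (-z)
  integrable : Integrable (fun z => K z * min 1 ‖z‖) volume
  one_le : ∀ z, z ≠ 0 → z ∈ ball (0 : Space n) 2 → 1 ≤ K z
  differentiable : ∀ z, z ≠ 0 → DifferentiableAt ℝ K z
  differentiable_fderiv : ∀ z, z ≠ 0 → DifferentiableAt ℝ (fderiv ℝ K) z
  first_le : ∀ z, z ≠ 0 → ∀ e : Space n, ‖e‖ = 1 → ‖z‖ * |fderiv ℝ K z e| ≤ Kstar z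
  second_le : ∀ z, z ≠ 0 → ∀ e : Space n, ‖e‖ = 1 → ∀ y : Space n, ‖y - z‖ ≤ ‖z‖ / 2 →
    ‖z‖ ^ 2 * |fderiv ℝ (fderiv ℝ K) y e e| ≤ Kstar z

/-- The controlling kernel `z ↦ C₁ (K(z) + χ_{|z| < R₀}(z))`. -/
def controlKernel {n : ℕ} (K : Space n → ℝ) (C₁ R₀ : ℝ) (z : Space n) : ℝ :=
  C₁ * (K z + indicator {w : Space n | ‖w‖ < R₀} (fun _ => (1 : ℝ)) z)

/-- The divergence of a vector field on `ℝⁿ`. -/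
def divergence {n : ℕ} (φ : Space n → Space n) (x : Space n) : ℝ :=
  ∑ i : Fin n, fderiv ℝ φ x (EuclideanSpace.single i 1) i

/-- The total variation `|∇u|(Ω)`: the supremum of `∫_Ω u div φ` over the vector fields
`φ ∈ C¹_c(Ω; ℝⁿ)` with `|φ| ≤ 1`. It is nonnegative (take `φ = 0`), so it may be computed
in `[0, ∞]`. -/
def totalVariation {n : ℕ} (Ω : Set (Space n)) (u : Space n → ℝ) : ℝ≥0∞ :=
  ⨆ (φ : Space n → Space n) (_ : ContDiff ℝ 1 φ) (_ : HasCompactSupport φ)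
    (_ : tsupport φ ⊆ Ω) (_ : ∀ x, ‖φ x‖ ≤ 1),
    ENNReal.ofReal (∫ x in Ω, u x * divergence φ x)

/-- The classical perimeter `Per_Ω(E) = |∇χ_E|(Ω)`. -/
def classicalPerimeter {n : ℕ} (Ω E : Set (Space n)) : ℝ≥0∞ :=
  totalVariation Ω (indicator E (fun _ => (1 : ℝ)))

end KPer

end

namespace KPer

/-! ### Second-order expansion of the deformed kernel -/

section

/-! Deform `E` by the maps `x ↦ x ± t φ(x) v`, where the cutoff `φ` is `1` on `B_2` and `0` off
`B_4`, so that both images `E_t`, `E_{-t}` are competitors. In `P(E_t) + P(E_{-t})` the terms odd in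
`t` cancel, and the bounds on the first and second derivatives of `K` leave `P(E_t) + P(E_{-t}) ≤ 2
P(E) + t² η`, with `η` of order `(C₁ + 1) P(E) + C₁` (`IsAdmissible.second_variation_le`).

Minimality is then used through strong submodularity: `P(E ∪ F) + P(E ∩ F) + L(F \ E, E \ F) ≤ P(E)
+ P(F)`. With `F = E_t`, the union, the intersection and `E_{-t}` all have perimeter at least
`P(E)`, so `L(E_t \ E, E \ E_t) ≤ t² η` (`IsAdmissible.interaction_deform_le`). In `B_1` the
deformation is translation by `t v`, and `K ≥ 1` at distances below `2`, so the product of the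
volumes gained and lost by `E` in `B_1` under this translation is at most `t² η`. These volumes
differ by only `O(t)`, since translation preserves measure up to a boundary layer. Hence the smaller
is at most `t √η` and their sum is `O(t (√η + 1))`. Dividing by `t` and letting `t → 0` bounds every
directional derivative of `χ_E`, hence the perimeter.

It remains to bound `√η + 1` by a multiple of `√(C₁ P_K(B_4))`. Comparison with `E ∪ B_4` gives
`P(E) ≤ P_K(B_4)`, and `K ≥ 1` near the origin bounds `P_K(B_4)` below. `C₁` is also bounded below
(`IsAdmissible.constant_gt`): a small `C₁` would make `K` decay too slowly to be integrable at
infinity. -/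

/-- First and second symmetric differences of a twice differentiable function on the line. -/
theorem symmetric_difference_bounds {g g' g'' : ℝ → ℝ} {h B D : ℝ}
    (hg : ∀ s, |s| ≤ |h| → HasDerivAt g (g' s) s)
    (hg' : ∀ s, |s| ≤ |h| → HasDerivAt g' (g'' s) s)
    (hB : |g' 0| ≤ B) (hD : ∀ s, |s| ≤ |h| → |g'' s| ≤ D) :
    |g h - g (-h)| ≤ 2 * |h| * (B + D * |h|) ∧ |g h + g (-h) - 2 * g 0| ≤ 2 * D * h ^ 2 := by
  have hconv : Convex ℝ {s : ℝ | |s| ≤ |h|} := by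
    have : {s : ℝ | |s| ≤ |h|} = Icc (-|h|) |h| := by ext s; simp [abs_le]
    rw [this]; exact convex_Icc _ _
  have h0 : (0 : ℝ) ∈ {s : ℝ | |s| ≤ |h|} := by simp
  have hh : h ∈ {s : ℝ | |s| ≤ |h|} := by simp
  have hnh : -h ∈ {s : ℝ | |s| ≤ |h|} := by simp
  have hD0 : 0 ≤ D := (abs_nonneg _).trans (hD 0 h0)
  have lip : ∀ s, |s| ≤ |h| → ∀ r, |r| ≤ |h| → |g' s - g' r| ≤ D * |s - r| := fun s hs r hr =>
    hconv.norm_image_sub_le_of_norm_hasDerivWithin_le (f := g') (f' := g'') (C := D)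
      (fun x hx => (hg' x hx).hasDerivWithinAt) hD hr hs
  have first : ∀ s ∈ {s : ℝ | |s| ≤ |h|}, ‖g' s‖ ≤ B + D * |h| := by
    intro s hs
    have h1 := lip s hs 0 h0
    rw [sub_zero] at h1
    have h2 : |g' s| ≤ |g' s - g' 0| + |g' 0| := by
      simpa using abs_add_le (g' s - g' 0) (g' 0)
    have h3 : D * |s| ≤ D * |h| := mul_le_mul_of_nonneg_left hs hD0
    rw [Real.norm_eq_abs]; linarith
  constructor
  · have := hconv.norm_image_sub_le_of_norm_hasDerivWithin_le (f := g) (f' := g')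
      (fun x hx => (hg x hx).hasDerivWithinAt) first hnh hh
    rw [Real.norm_eq_abs, Real.norm_eq_abs] at this
    have e : |h - -h| = 2 * |h| := by
      rw [sub_neg_eq_add, ← two_mul, abs_mul, abs_two]
    rw [e] at this; linarith
  · have hq : ∀ s ∈ {s : ℝ | |s| ≤ |h|},
        HasDerivWithinAt (fun s => g s + g (-s)) (g' s - g' (-s)) {s : ℝ | |s| ≤ |h|} s := by
      intro s hs
      have h1 : HasDerivAt g (g' (-s)) (-s) := hg (-s) (by simpa using hs)
      have h2 := h1.comp s (hasDerivAt_neg s)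
      have h3 := (hg s hs).add h2
      refine (h3.congr_deriv ?_).hasDerivWithinAt
      ring
    have hb : ∀ s ∈ {s : ℝ | |s| ≤ |h|}, ‖g' s - g' (-s)‖ ≤ 2 * D * |h| := by
      intro s hs
      have h1 := lip s hs (-s) (by simpa using hs)
      have e : |s - -s| = 2 * |s| := by rw [sub_neg_eq_add, ← two_mul, abs_mul, abs_two]
      have h3 : D * |s| ≤ D * |h| := mul_le_mul_of_nonneg_left hs hD0
      rw [e] at h1
      rw [Real.norm_eq_abs]; linarith
    have := hconv.norm_image_sub_le_of_norm_hasDerivWithin_le hq hb h0 hh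
    simp only [neg_zero, sub_zero, Real.norm_eq_abs] at this
    have e : |h| * |h| = h ^ 2 := by rw [← sq, sq_abs]
    have e2 : g h + g (-h) - 2 * g 0 = g h + g (-h) - (g 0 + g 0) := by ring
    rw [e2, ← e]; linarith

/-- Here `p`, `q`, `k` stand for `K` at `z ± tεv` and at `z`, `S` for `Kstar z`, `r` for `|z|`, and
`a`, `b` for the derivatives of the cutoff at the two points. The sum equals `(p + q) + t²(p + q)ab
+ (p - q)t(a + b)`: the only term with a single factor `t` also carries `p - q = O(t)`. The three
pieces contribute `2`, `1` and `6` multiples of `S`, so `11` leaves some room. -/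
theorem weighted_sum_le {p q k S L t a b ε r : ℝ} (hS : 0 ≤ S) (hp : 0 ≤ p)
    (hq : 0 ≤ q) (hr : 0 < r) (hL : 0 ≤ L) (ha : |a| ≤ L) (hb : |b| ≤ L) (hε : |ε| ≤ L * r)
    (ht : |t| * L ≤ 1 / 2)
    (h1 : |p - q| ≤ 2 * |t * ε| * (S / r + S / r ^ 2 * |t * ε|))
    (h2 : |p + q - 2 * k| ≤ 2 * (S / r ^ 2) * (t * ε) ^ 2) :
    p * ((1 + t * a) * (1 + t * b)) + q * ((1 - t * a) * (1 - t * b)) ≤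
      2 * k + t ^ 2 * (L ^ 2 * (11 * S + 2 * k)) := by
  set T := |t| with hT
  have hT0 : 0 ≤ T := abs_nonneg t
  have hTsq : t ^ 2 = T ^ 2 := (sq_abs t).symm
  have hte : |t * ε| ≤ T * (L * r) := by
    rw [abs_mul]; exact mul_le_mul_of_nonneg_left hε hT0
  have hte0 : 0 ≤ |t * ε| := abs_nonneg _
  have hSr : 0 ≤ S / r ^ 2 := by positivity
  have h1' : |p - q| ≤ 3 * (T * L * S) := by
    refine h1.trans ?_
    have : 2 * |t * ε| * (S / r + S / r ^ 2 * |t * ε|)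
        ≤ 2 * (T * (L * r)) * (S / r + S / r ^ 2 * (T * (L * r))) := by
      gcongr
    refine this.trans ?_
    have e : 2 * (T * (L * r)) * (S / r + S / r ^ 2 * (T * (L * r)))
        = T * L * S * (2 + 2 * (T * L)) := by field_simp
    rw [e]
    have : 0 ≤ T * L * S := by positivity
    nlinarith
  have h2' : |p + q - 2 * k| ≤ 2 * (T ^ 2 * L ^ 2 * S) := by
    refine h2.trans ?_
    have : (t * ε) ^ 2 ≤ (T * (L * r)) ^ 2 := by
      rw [← sq_abs]; gcongr
    calc 2 * (S / r ^ 2) * (t * ε) ^ 2 ≤ 2 * (S / r ^ 2) * (T * (L * r)) ^ 2 := by gcongr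
      _ = 2 * (T ^ 2 * L ^ 2 * S) := by field_simp
  have hsum : p + q ≤ 2 * k + 2 * (T ^ 2 * L ^ 2 * S) := by linarith [le_abs_self (p + q - 2 * k)]
  have hab : a * b ≤ L ^ 2 := by
    calc a * b ≤ |a| * |b| := by rw [← abs_mul]; exact le_abs_self _
      _ ≤ L * L := by gcongr
      _ = L ^ 2 := by ring
  have hcross : (p - q) * (t * (a + b)) ≤ 3 * (T * L * S) * (T * (2 * L)) := by
    calc (p - q) * (t * (a + b)) ≤ |p - q| * |t * (a + b)| := by
          rw [← abs_mul]; exact le_abs_self _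
      _ ≤ 3 * (T * L * S) * (T * (2 * L)) := by
          rw [abs_mul t]
          have : |a + b| ≤ 2 * L := (abs_add_le a b).trans (by linarith)
          gcongr
  have hmid : (p + q) * (a * b) ≤ (2 * k + 2 * (T ^ 2 * L ^ 2 * S)) * L ^ 2 :=
    (mul_le_mul_of_nonneg_left hab (by linarith)).trans
      (mul_le_mul_of_nonneg_right hsum (sq_nonneg L))
  have hTL : T ^ 2 * L ^ 2 ≤ 1 / 4 := by
    have : (T * L) ^ 2 ≤ (1 / 2) ^ 2 := by gcongr
    nlinarith
  have hmid2 : T ^ 2 * ((p + q) * (a * b)) ≤ T ^ 2 * L ^ 2 * (2 * k + S) := by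
    calc T ^ 2 * ((p + q) * (a * b))
        ≤ T ^ 2 * ((2 * k + 2 * (T ^ 2 * L ^ 2 * S)) * L ^ 2) := by gcongr
      _ = T ^ 2 * L ^ 2 * (2 * k + 2 * (T ^ 2 * L ^ 2) * S) := by ring
      _ ≤ T ^ 2 * L ^ 2 * (2 * k + S) := by
          gcongr
          nlinarith
  have e : p * ((1 + t * a) * (1 + t * b)) + q * ((1 - t * a) * (1 - t * b))
      = (p + q) + t ^ 2 * ((p + q) * (a * b)) + (p - q) * (t * (a + b)) := by ring
  rw [e, hTsq]
  have : 0 ≤ T ^ 2 * L ^ 2 * S := by positivity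
  nlinarith

variable {n : ℕ} {K Kstar : Space n → ℝ}

theorem IsAdmissible.kstar_nonneg (hK : IsAdmissible K Kstar) (hn : 1 ≤ n) {z : Space n}
    (hz : z ≠ 0) : 0 ≤ Kstar z := by
  let e : Space n := EuclideanSpace.single ⟨0, hn⟩ 1
  have he : ‖e‖ = 1 := by simp [e]
  exact le_trans (by positivity) (hK.first_le z hz e he)

theorem IsAdmissible.weighted_second_variation_le (hK : IsAdmissible K Kstar)
    {v z : Space n} (hv : ‖v‖ = 1) (hz : z ≠ 0) {L t a b ε : ℝ} (hL : 0 ≤ L)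
    (ha : |a| ≤ L) (hb : |b| ≤ L) (hε : |ε| ≤ L * ‖z‖) (ht : |t| * L ≤ 1 / 2) :
    K (z + (t * ε) • v) * ((1 + t * a) * (1 + t * b)) +
      K (z - (t * ε) • v) * ((1 - t * a) * (1 - t * b)) ≤
      2 * K z + t ^ 2 * (L ^ 2 * (11 * Kstar z + 2 * K z)) := by
  have hr : 0 < ‖z‖ := norm_pos_iff.2 hz
  have hS : 0 ≤ Kstar z := le_trans (by positivity) (hK.first_le z hz v hv)
  have hsmall : |t * ε| ≤ ‖z‖ / 2 := by
    rw [abs_mul]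
    calc |t| * |ε| ≤ |t| * (L * ‖z‖) := by gcongr
      _ = |t| * L * ‖z‖ := by ring
      _ ≤ 1 / 2 * ‖z‖ := by gcongr
      _ = ‖z‖ / 2 := by ring
  have hdist : ∀ s : ℝ, |s| ≤ |t * ε| → ‖z + s • v - z‖ ≤ ‖z‖ / 2 := by
    intro s hs
    rw [add_sub_cancel_left, norm_smul, hv, mul_one, Real.norm_eq_abs]
    exact hs.trans hsmall
  have hne : ∀ s : ℝ, |s| ≤ |t * ε| → z + s • v ≠ 0 := by
    intro s hs h0
    have := hdist s hs
    rw [h0, zero_sub, norm_neg] at this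
    linarith
  have hline : ∀ s : ℝ, HasDerivAt (fun s : ℝ => z + s • v) v s := by
    intro s
    simpa using ((hasDerivAt_id s).smul_const v).const_add z
  have hg : ∀ s : ℝ, |s| ≤ |t * ε| →
      HasDerivAt (fun s : ℝ => K (z + s • v)) (fderiv ℝ K (z + s • v) v) s := fun s hs =>
    (hK.differentiable _ (hne s hs)).hasFDerivAt.comp_hasDerivAt s (hline s)
  have hg' : ∀ s : ℝ, |s| ≤ |t * ε| →
      HasDerivAt (fun s : ℝ => fderiv ℝ K (z + s • v) v)
        (fderiv ℝ (fderiv ℝ K) (z + s • v) v v) s := by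
    intro s hs
    have h1 := (hK.differentiable_fderiv _ (hne s hs)).hasFDerivAt.comp_hasDerivAt s (hline s)
    simpa using h1.clm_apply (hasDerivAt_const s v)
  have hB : |fderiv ℝ K (z + (0 : ℝ) • v) v| ≤ Kstar z / ‖z‖ := by
    rw [zero_smul, add_zero, le_div_iff₀ hr, mul_comm]
    exact hK.first_le z hz v hv
  have hD : ∀ s : ℝ, |s| ≤ |t * ε| →
      |fderiv ℝ (fderiv ℝ K) (z + s • v) v v| ≤ Kstar z / ‖z‖ ^ 2 := by
    intro s hs
    rw [le_div_iff₀ (by positivity), mul_comm]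
    exact hK.second_le z hz v hv _ (hdist s hs)
  obtain ⟨h1, h2⟩ := symmetric_difference_bounds (h := t * ε) hg hg' hB hD
  simp only [neg_smul, ← sub_eq_add_neg, zero_smul, add_zero] at h1 h2
  refine weighted_sum_le hS (hK.nonneg _ (hne _ le_rfl)) ?_ hr hL ha hb hε ht h1 h2
  have := hne (-(t * ε)) (by simp)
  rw [neg_smul, ← sub_eq_add_neg] at this
  exact hK.nonneg _ this

end

/-! ### Slow decay along rays and a lower bound for `C₁` -/

section

/-- The derivative of `f(s) s^C` is `s^(C-1) (s f' + C f) ≥ 0`: the differential inequality forbids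
decay faster than `s^(-C)`. -/
theorem mul_rpow_le_mul_rpow {f f' : ℝ → ℝ} {a b C : ℝ} (ha : 0 < a) (hab : a ≤ b)
    (hf : ∀ s ∈ Icc a b, HasDerivAt f (f' s) s)
    (hf' : ∀ s ∈ Icc a b, -(C * f s) ≤ s * f' s) : f a * a ^ C ≤ f b * b ^ C := by
  have hd : ∀ s ∈ Icc a b,
      HasDerivAt (fun s => f s * s ^ C) (f' s * s ^ C + f s * (C * s ^ (C - 1))) s := fun s hs =>
    (hf s hs).mul (Real.hasDerivAt_rpow_const (Or.inl (ha.trans_le hs.1).ne'))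
  refine monotoneOn_of_deriv_nonneg (convex_Icc a b)
    (fun s hs => (hd s hs).continuousAt.continuousWithinAt)
    (fun s hs => (hd s (interior_subset hs)).differentiableAt.differentiableWithinAt) ?_
    (left_mem_Icc.2 hab) (right_mem_Icc.2 hab) hab
  intro s hs
  have hs' := interior_subset hs
  have hpos : 0 < s := ha.trans_le hs'.1
  rw [(hd s hs').deriv]
  have e : f' s * s ^ C + f s * (C * s ^ (C - 1)) = s ^ (C - 1) * (s * f' s + C * f s) := by
    have : s ^ C = s ^ (C - 1) * s := by
      rw [Real.rpow_sub_one hpos.ne']; field_simp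
    rw [this]; ring
  rw [e]
  exact mul_nonneg (Real.rpow_nonneg hpos.le _) (by linarith [hf' s hs'])

variable {n : ℕ} {K Kstar : Space n → ℝ} {C₁ R₀ : ℝ}

theorem IsAdmissible.measurable (hK : IsAdmissible K Kstar) : Measurable K :=
  measurable_of_continuousOn_compl_singleton 0 fun z hz =>
    (hK.differentiable z hz).continuousAt.continuousWithinAt

theorem IsAdmissible.hasDerivAt_ray (hK : IsAdmissible K Kstar) {u : Space n} (hu : ‖u‖ = 1)
    {s : ℝ} (hs : 0 < s) :
    HasDerivAt (fun s : ℝ => K (s • u)) (fderiv ℝ K (s • u) u) s := by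
  have hu0 : u ≠ 0 := by rintro rfl; simp at hu
  have h := (hasDerivAt_id s).smul_const u
  rw [one_smul] at h
  exact (hK.differentiable _ (smul_ne_zero hs.ne' hu0)).hasFDerivAt.comp_hasDerivAt s h

theorem IsAdmissible.neg_le_ray_deriv (hK : IsAdmissible K Kstar) {u : Space n} (hu : ‖u‖ = 1)
    {s : ℝ} (hs : 0 < s) : -(Kstar (s • u)) ≤ s * fderiv ℝ K (s • u) u := by
  have hu0 : u ≠ 0 := by rintro rfl; simp at hu
  have h := hK.first_le _ (smul_ne_zero hs.ne' hu0) u hu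
  rw [norm_smul, hu, mul_one, Real.norm_of_nonneg hs.le] at h
  have := mul_le_mul_of_nonneg_left (neg_abs_le (fderiv ℝ K (s • u) u)) hs.le
  linarith

theorem controlKernel_le (hC : 0 ≤ C₁) (z : Space n) :
    controlKernel K C₁ R₀ z ≤ C₁ * (K z + 1) := by
  unfold controlKernel
  refine mul_le_mul_of_nonneg_left ?_ hC
  gcongr
  exact indicator_le_self' (fun _ _ => zero_le_one) z

theorem controlKernel_of_le {z : Space n} (hz : R₀ ≤ ‖z‖) :
    controlKernel K C₁ R₀ z = C₁ * K z := by
  unfold controlKernel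
  rw [indicator_of_notMem (by simpa using hz), add_zero]

theorem IsAdmissible.constant_nonneg (hK : IsAdmissible K (controlKernel K C₁ R₀)) (hn : 1 ≤ n)
    (hR : 2 ≤ R₀) : 0 ≤ C₁ := by
  let e : Space n := EuclideanSpace.single ⟨0, hn⟩ 1
  have he : ‖e‖ = 1 := by simp [e]
  have he0 : e ≠ 0 := by intro h; simp [h] at he
  have h1 := hK.kstar_nonneg hn he0
  have h2 := hK.one_le e he0 (by rw [mem_ball_zero_iff, he]; norm_num)
  unfold controlKernel at h1
  rw [indicator_of_mem (by simp only [mem_ofPred_eq, he]; linarith)] at h1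
  by_contra! h
  nlinarith

/-- Up to radius `R₀` the controlling kernel is at most `C₁ (K + 1)`, so the decay bound applies to
`K + 1`, which is at least `2` on the unit sphere. It is therefore at least `2 / (3/2) > 1` at
radius `R₀`, so `K > 0` there. Beyond `R₀` the bound applies to `K` itself and positivity propagates
outwards. -/
theorem IsAdmissible.pos_of_lt_norm (hK : IsAdmissible K (controlKernel K C₁ R₀)) (hn : 1 ≤ n)
    (hR : 2 ≤ R₀) (hC : R₀ ^ C₁ ≤ 3 / 2) {z : Space n} (hz : R₀ < ‖z‖) : 0 < K z := by
  have hC0 := hK.constant_nonneg hn hR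
  have hz0 : 0 < ‖z‖ := by linarith
  obtain ⟨u, hu, hzu⟩ : ∃ u : Space n, ‖u‖ = 1 ∧ z = ‖z‖ • u :=
    ⟨‖z‖⁻¹ • z, by rw [norm_smul, norm_inv, norm_norm, inv_mul_cancel₀ hz0.ne'],
      by rw [smul_inv_smul₀ hz0.ne']⟩
  have hu0 : u ≠ 0 := by rintro rfl; simp at hu
  have h1 := mul_rpow_le_mul_rpow (f := fun s => K (s • u) + 1) (a := 1) (b := R₀) (C := C₁)
    one_pos (by linarith)
    (fun s hs => (hK.hasDerivAt_ray hu (one_pos.trans_le hs.1)).add_const 1)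
    (fun s hs => (neg_le_neg (controlKernel_le hC0 _)).trans
      (hK.neg_le_ray_deriv hu (one_pos.trans_le hs.1)))
  have h2 := mul_rpow_le_mul_rpow (f := fun s => K (s • u)) (a := R₀) (b := ‖z‖) (C := C₁)
    (by linarith) hz.le
    (fun s hs => hK.hasDerivAt_ray hu (by linarith [hs.1]))
    (fun s hs => by
      have hs0 : 0 < s := by linarith [hs.1]
      have := hK.neg_le_ray_deriv hu hs0
      rwa [controlKernel_of_le (by
        rw [norm_smul, hu, mul_one, Real.norm_of_nonneg hs0.le]; exact hs.1)] at this)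
  have hK1 : 1 ≤ K u := hK.one_le u hu0 (by rw [mem_ball_zero_iff, hu]; norm_num)
  simp only [one_smul, Real.one_rpow, mul_one] at h1
  rw [← hzu] at h2
  have hRK : 0 ≤ K (R₀ • u) := hK.nonneg _ (smul_ne_zero (by linarith) hu0)
  have hpos : 0 < K (R₀ • u) := by nlinarith
  have : 0 < K z * ‖z‖ ^ C₁ :=
    (mul_pos hpos (Real.rpow_pos_of_pos (by linarith) _)).trans_le h2
  exact pos_of_mul_pos_left this (Real.rpow_nonneg hz0.le _)

theorem IsAdmissible.le_comp_two_smul (hK : IsAdmissible K (controlKernel K C₁ R₀))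
    (hR : 2 ≤ R₀) {z : Space n} (hz : R₀ < ‖z‖) : K z ≤ 2 ^ C₁ * K ((2 : ℝ) • z) := by
  have hz0 : 0 < ‖z‖ := by linarith
  obtain ⟨u, hu, hzu⟩ : ∃ u : Space n, ‖u‖ = 1 ∧ z = ‖z‖ • u :=
    ⟨‖z‖⁻¹ • z, by rw [norm_smul, norm_inv, norm_norm, inv_mul_cancel₀ hz0.ne'],
      by rw [smul_inv_smul₀ hz0.ne']⟩
  have h2 := mul_rpow_le_mul_rpow (f := fun s => K (s • u)) (a := ‖z‖) (b := 2 * ‖z‖) (C := C₁)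
    hz0 (by linarith)
    (fun s hs => hK.hasDerivAt_ray hu (by linarith [hs.1]))
    (fun s hs => by
      have hs0 : 0 < s := by linarith [hs.1]
      have := hK.neg_le_ray_deriv hu hs0
      rwa [controlKernel_of_le (by
        rw [norm_smul, hu, mul_one, Real.norm_of_nonneg hs0.le]; linarith [hs.1])] at this)
  rw [mul_smul, ← hzu, Real.mul_rpow zero_le_two hz0.le] at h2
  have hp : 0 < ‖z‖ ^ C₁ := Real.rpow_pos_of_pos hz0 _
  refine le_of_mul_le_mul_right ?_ hp
  calc K z * ‖z‖ ^ C₁ ≤ _ := h2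
    _ = _ := by ring

theorem IsAdmissible.lintegral_lt_top (hK : IsAdmissible K Kstar) :
    ∫⁻ z, ENNReal.ofReal (K z) * ENNReal.ofReal (min 1 ‖z‖) < ∞ := by
  have h := hK.integrable.lintegral_lt_top
  refine lt_of_eq_of_lt (lintegral_congr fun z => ?_) h
  rw [ENNReal.ofReal_mul' (by positivity)]

/-- The integrability of the kernel at infinity bounds the constant `C₁` from below. -/
theorem IsAdmissible.constant_gt (hK : IsAdmissible K (controlKernel K C₁ R₀)) (hn : 1 ≤ n)
    (hR : 2 ≤ R₀) : 3 / 2 < R₀ ^ C₁ := by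
  by_contra! hC
  have hC0 := hK.constant_nonneg hn hR
  have h2C : (2 : ℝ) ^ C₁ ≤ 3 / 2 := (Real.rpow_le_rpow zero_le_two hR hC0).trans hC
  -- The tail integral `I` of `K` over `A` is finite and positive. Slow decay gives `K(z) ≤ (3/2)
  -- K(2z)` on `A`, and the change of variables `z ↦ 2z` turns this into `I ≤ (3/2) 2^(-n) I < I`.
  set A : Set (Space n) := {z | R₀ < ‖z‖} with hA
  have hAo : IsOpen A := isOpen_lt continuous_const continuous_norm
  set k : Space n → ℝ≥0∞ := fun z => ENNReal.ofReal (K z) with hk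
  have hkm : Measurable k := hK.measurable.ennreal_ofReal
  set I := ∫⁻ z, A.indicator k z with hI
  have hIfin : I < ∞ := by
    refine lt_of_le_of_lt (lintegral_mono fun z => ?_) hK.lintegral_lt_top
    by_cases hz : z ∈ A
    · have hz' : R₀ < ‖z‖ := hz
      rw [indicator_of_mem hz, min_eq_left (by linarith), ENNReal.ofReal_one, mul_one]
    · rw [indicator_of_notMem hz]; exact zero_le
  have hIpos : I ≠ 0 := by
    intro h0
    rw [hI, lintegral_eq_zero_iff (hkm.indicator hAo.measurableSet)] at h0
    have hA0 : volume A = 0 := by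
      refine measure_mono_null (fun z hz => ?_) h0
      have := hK.pos_of_lt_norm hn hR hC hz
      simp only [mem_compl_iff, mem_ofPred_eq, indicator_of_mem hz, hk, Pi.zero_apply,
        ENNReal.ofReal_eq_zero, not_le]
      exact this
    refine (hAo.measure_pos volume ⟨EuclideanSpace.single ⟨0, hn⟩ (R₀ + 1), ?_⟩).ne' hA0
    simp only [hA, mem_ofPred_eq, PiLp.norm_single, Real.norm_eq_abs]
    rw [abs_of_nonneg (by linarith)]; linarith
  have hscale : ∫⁻ z, A.indicator k ((2 : ℝ) • z) = ENNReal.ofReal ((2 ^ n)⁻¹) * I := by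
    have := Measure.map_addHaar_smul (volume : Measure (Space n)) (r := 2) two_ne_zero
    rw [hI, ← lintegral_map (hkm.indicator hAo.measurableSet) (measurable_const_smul _), this,
      lintegral_smul_measure]
    simp
  have hle : I ≤ ENNReal.ofReal (3 / 2) * ∫⁻ z, A.indicator k ((2 : ℝ) • z) := by
    rw [hI, ← lintegral_const_mul' _ _ ENNReal.ofReal_ne_top]
    refine lintegral_mono fun z => ?_
    by_cases hz : z ∈ A
    · have hz' : R₀ < ‖z‖ := hz
      have hz2 : (2 : ℝ) • z ∈ A := by
        simp only [hA, mem_ofPred_eq, norm_smul, Real.norm_two]; linarith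
      rw [indicator_of_mem hz, indicator_of_mem hz2, ← ENNReal.ofReal_mul (by norm_num)]
      refine ENNReal.ofReal_le_ofReal ((hK.le_comp_two_smul hR hz').trans ?_)
      refine mul_le_mul_of_nonneg_right h2C (hK.nonneg _ (smul_ne_zero two_ne_zero ?_))
      rintro rfl; simp only [norm_zero] at hz'; linarith
    · rw [indicator_of_notMem hz]; exact zero_le
  rw [hscale, ← mul_assoc, ← ENNReal.ofReal_mul (by norm_num)] at hle
  have hlt : ENNReal.ofReal (3 / 2 * (2 ^ n)⁻¹) < 1 := by
    rw [ENNReal.ofReal_lt_one, ← div_eq_mul_inv, div_lt_one (by positivity)]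
    calc (3 / 2 : ℝ) < 2 ^ 1 := by norm_num
      _ ≤ 2 ^ n := pow_le_pow_right₀ one_le_two hn
  have := ENNReal.mul_lt_mul_left hIpos hIfin.ne hlt
  rw [one_mul] at this
  exact absurd hle (not_le.2 this)

theorem exists_constant_lower_bound (n : ℕ) (hn : 1 ≤ n) (R₀ : ℝ) (hR : 2 ≤ R₀) :
    ∃ c : ℝ, 0 < c ∧ ∀ (K : Space n → ℝ) (C₁ : ℝ), IsAdmissible K (controlKernel K C₁ R₀) →
      c ≤ C₁ := by
  have hlog : 0 < Real.log R₀ := Real.log_pos (by linarith)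
  refine ⟨Real.log (3 / 2) / Real.log R₀, div_pos (Real.log_pos (by norm_num)) hlog,
    fun K C₁ hK => ?_⟩
  rw [div_le_iff₀ hlog, ← Real.log_rpow (by linarith)]
  exact Real.log_le_log (by norm_num) (hK.constant_gt hn hR).le

end

/-! ### Finiteness and lower bound of `P_K(B_4)` -/

section

variable {n : ℕ} {K Kstar : Space n → ℝ} {C₁ R₀ : ℝ}

/-- A ball and its translate by `z` differ by a set of measure `O(|z|)`. -/
theorem volume_ball_inter_shift_le (hn : 1 ≤ n) {r : ℝ} (hr : 0 < r) (z : Space n) :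
    volume {x : Space n | x ∈ ball 0 r ∧ x - z ∉ ball 0 r} ≤
      volume (ball (0 : Space n) r) * ENNReal.ofReal (n * (‖z‖ / r)) := by
  have hn' : (1 : ℝ) ≤ n := by exact_mod_cast hn
  set V := volume (ball (0 : Space n) r) with hV
  set s := ‖z‖ / r with hs
  have hs0 : 0 ≤ s := by positivity
  by_cases h : 1 ≤ s
  · calc volume {x : Space n | x ∈ ball 0 r ∧ x - z ∉ ball 0 r} ≤ V * 1 := by
          rw [mul_one]; exact measure_mono fun x hx => hx.1
      _ ≤ V * ENNReal.ofReal (n * s) := by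
          gcongr
          rw [ENNReal.one_le_ofReal]
          nlinarith
  push Not at h
  have hsub : {x : Space n | x ∈ ball 0 r ∧ x - z ∉ ball 0 r} ⊆
      ball 0 r \ ball 0 ((1 - s) * r) := by
    rintro x ⟨hx, hxz⟩
    refine ⟨hx, fun hx' => hxz ?_⟩
    rw [mem_ball_zero_iff] at hx' ⊢
    have e : (1 - s) * r = r - ‖z‖ := by rw [hs]; field_simp
    rw [e] at hx'
    linarith [norm_sub_le x z]
  have hW := Measure.addHaar_ball_mul_of_pos (volume : Measure (Space n)) 0
    (sub_pos.2 h) r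
  rw [finrank_euclideanSpace_fin, ← hV] at hW
  refine (measure_mono hsub).trans ?_
  have hle : (1 - s) * r ≤ r := by nlinarith
  rw [measure_sdiff (ball_subset_ball hle) measurableSet_ball.nullMeasurableSet
    measure_ball_lt_top.ne, hW, tsub_le_iff_right, mul_comm _ V, ← mul_add,
    ← ENNReal.ofReal_add (by positivity) (pow_nonneg (by linarith) _)]
  calc V = V * 1 := (mul_one V).symm
    _ ≤ _ := by
      gcongr
      rw [ENNReal.one_le_ofReal]
      -- Bernoulli's inequality: `(1 - s)^n ≥ 1 - n s`.
      have := one_add_mul_le_pow (a := -s) (by linarith) n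
      rw [← sub_eq_add_neg] at this
      linarith

/-- Substitute `y = x - z` and apply Tonelli. For a ball the volume factor is `O(min 1 |z|)`,
exactly the weight against which `K` is integrable. -/
theorem perimeter_eq_lintegral_shift (hK : Measurable K) {B : Set (Space n)}
    (hB : MeasurableSet B) :
    perimeter K B = ∫⁻ z, ENNReal.ofReal (K z) * volume {x | x ∈ B ∧ x - z ∉ B} := by
  have hS : MeasurableSet {p : Space n × Space n | p.1 ∈ B ∧ p.1 - p.2 ∉ B} :=
    (measurable_fst hB).inter ((measurable_fst.sub measurable_snd) hB).compl
  have hm : Measurable fun p : Space n × Space n =>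
      {p : Space n × Space n | p.1 ∈ B ∧ p.1 - p.2 ∉ B}.indicator
        (fun p => ENNReal.ofReal (K p.2)) p :=
    (hK.comp measurable_snd).ennreal_ofReal.indicator hS
  have h1 : perimeter K B = ∫⁻ x, ∫⁻ z,
      {p : Space n × Space n | p.1 ∈ B ∧ p.1 - p.2 ∉ B}.indicator
        (fun p => ENNReal.ofReal (K p.2)) (x, z) := by
    unfold perimeter interaction
    rw [← lintegral_indicator hB]
    refine lintegral_congr fun x => ?_
    by_cases hx : x ∈ B
    · rw [indicator_of_mem hx, ← lintegral_indicator hB.compl,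
        ← lintegral_sub_left_eq_self _ x]
      refine lintegral_congr fun z => ?_
      by_cases hz : x - z ∈ B <;> simp [indicator, hx, hz]
    · rw [indicator_of_notMem hx]
      simp [indicator, hx]
  rw [h1, lintegral_lintegral_swap hm.aemeasurable]
  refine lintegral_congr fun z => ?_
  have : ∀ x, {p : Space n × Space n | p.1 ∈ B ∧ p.1 - p.2 ∉ B}.indicator
        (fun p => ENNReal.ofReal (K p.2)) (x, z) =
      {x | x ∈ B ∧ x - z ∉ B}.indicator (fun _ => ENNReal.ofReal (K z)) x := fun x => rfl
  simp_rw [this]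
  exact lintegral_indicator_const (hB.inter ((measurable_id.sub_const z) hB).compl) _

theorem IsAdmissible.perimeter_ball_lt_top (hK : IsAdmissible K Kstar) (hn : 1 ≤ n) {r : ℝ}
    (hr : 1 ≤ r) : perimeter K (ball 0 r) < ∞ := by
  have hn' : (1 : ℝ) ≤ n := by exact_mod_cast hn
  rw [perimeter_eq_lintegral_shift hK.measurable measurableSet_ball]
  set V := volume (ball (0 : Space n) r) with hV
  have hVfin : V ≠ ∞ := measure_ball_lt_top.ne
  have key : ∀ z : Space n, volume {x : Space n | x ∈ ball 0 r ∧ x - z ∉ ball 0 r} ≤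
      V * ENNReal.ofReal n * ENNReal.ofReal (min 1 ‖z‖) := by
    intro z
    rw [mul_assoc, ← ENNReal.ofReal_mul (by positivity)]
    rcases le_total 1 ‖z‖ with h | h
    · rw [min_eq_left h, mul_one]
      calc _ ≤ V * 1 := by rw [mul_one]; exact measure_mono fun x hx => hx.1
        _ ≤ _ := by
          gcongr
          rwa [ENNReal.one_le_ofReal]
    · rw [min_eq_right h]
      refine (volume_ball_inter_shift_le hn (by linarith) z).trans ?_
      gcongr
      exact div_le_self (norm_nonneg _) hr
  calc _ ≤ ∫⁻ z, (V * ENNReal.ofReal n) *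
        (ENNReal.ofReal (K z) * ENNReal.ofReal (min 1 ‖z‖)) := by
        refine lintegral_mono fun z => ?_
        refine (mul_le_mul_right (key z) _).trans_eq ?_
        ring
    _ < ∞ := by
        rw [lintegral_const_mul' _ _ (ENNReal.mul_ne_top hVfin ENNReal.ofReal_ne_top)]
        exact ENNReal.mul_lt_top (ENNReal.mul_lt_top hVfin.lt_top ENNReal.ofReal_lt_top)
          hK.lintegral_lt_top

theorem interaction_mono {A A' B B' : Set (Space n)} (hA : A ⊆ A') (hB : B ⊆ B') :
    interaction K A B ≤ interaction K A' B' :=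
  (lintegral_mono fun _ => lintegral_mono_set hB).trans (lintegral_mono_set hA)

theorem IsAdmissible.volume_mul_le_interaction (hK : IsAdmissible K Kstar) {A B : Set (Space n)}
    (hA : MeasurableSet A) (hB : MeasurableSet B) (hdisj : Disjoint A B)
    (hdist : ∀ x ∈ A, ∀ y ∈ B, ‖x - y‖ < 2) :
    volume A * volume B ≤ interaction K A B := by
  unfold interaction
  calc volume A * volume B = ∫⁻ x in A, ∫⁻ y in B, 1 := by simp [mul_comm]
    _ ≤ _ := by
      refine setLIntegral_mono' hA fun x hx => setLIntegral_mono' hB fun y hy => ?_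
      rw [ENNReal.one_le_ofReal]
      refine hK.one_le _ (sub_ne_zero.2 (hdisj.ne_of_mem hx hy)) ?_
      rw [mem_ball_zero_iff]
      exact hdist x hx y hy

/-- Two balls of radius `1/2` touch the sphere of radius `4` at the same point from either side.
Their centres are at distance `1`, so all their points interact with `K ≥ 1`. -/
theorem IsAdmissible.volume_sq_le_perimeter (hK : IsAdmissible K Kstar) (hn : 1 ≤ n) :
    volume (ball (0 : Space n) (1 / 2)) * volume (ball (0 : Space n) (1 / 2)) ≤
      perimeter K (ball 0 4) := by
  let e : Space n := EuclideanSpace.single ⟨0, hn⟩ 1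
  have he : ‖e‖ = 1 := by simp [e]
  have hin : ball ((7 / 2 : ℝ) • e) (1 / 2) ⊆ ball 0 4 := by
    apply ball_subset_ball'
    rw [dist_zero_right, norm_smul, he]; norm_num
  have hout : ball ((9 / 2 : ℝ) • e) (1 / 2) ⊆ (ball 0 4)ᶜ := by
    intro y hy hy'
    rw [mem_ball_iff_norm] at hy
    rw [mem_ball_zero_iff] at hy'
    have h1 : ‖(9 / 2 : ℝ) • e‖ = 9 / 2 := by rw [norm_smul, he]; norm_num
    have h2 := norm_sub_norm_le ((9 / 2 : ℝ) • e) y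
    rw [norm_sub_rev] at h2
    linarith
  have h := hK.volume_mul_le_interaction (A := ball ((7 / 2 : ℝ) • e) (1 / 2))
    (B := ball ((9 / 2 : ℝ) • e) (1 / 2)) measurableSet_ball measurableSet_ball
    ((disjoint_compl_right.mono_left hin).mono_right hout) (by
      intro x hx y hy
      rw [mem_ball_iff_norm] at hx hy
      have e1 : x - y = (x - (7 / 2 : ℝ) • e) - (y - (9 / 2 : ℝ) • e) - e := by module
      rw [e1]
      have h1 := norm_sub_le ((x - (7 / 2 : ℝ) • e) - (y - (9 / 2 : ℝ) • e)) e
      have h2 := norm_sub_le (x - (7 / 2 : ℝ) • e) (y - (9 / 2 : ℝ) • e)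
      linarith)
  simp only [Measure.addHaar_ball_center] at h
  exact h.trans (interaction_mono hin hout)

end

/-! ### Submodularity, and change of variables under the deformation -/

section

variable {n : ℕ} {K Kstar : Space n → ℝ} {C₁ R₀ : ℝ}

/-- The pairs of points separated by `E` that interact inside `Ω`. -/
def crossing (Ω E : Set (Space n)) : Set (Space n × Space n) :=
  {p | p.1 ∈ E ∧ p.2 ∉ E ∧ (p.1 ∈ Ω ∨ p.2 ∈ Ω)}

theorem measurableSet_crossing {Ω E : Set (Space n)} (hΩ : MeasurableSet Ω)
    (hE : MeasurableSet E) : MeasurableSet (crossing Ω E) :=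
  (measurable_fst hE).inter ((measurable_snd hE).compl.inter
    ((measurable_fst hΩ).union (measurable_snd hΩ)))

theorem measurable_kernel_sub (hK : Measurable K) :
    Measurable fun p : Space n × Space n => ENNReal.ofReal (K (p.1 - p.2)) :=
  (hK.comp (measurable_fst.sub measurable_snd)).ennreal_ofReal

theorem interaction_eq_setLIntegral_prod (hK : Measurable K) (A B : Set (Space n)) :
    interaction K A B = ∫⁻ p in A ×ˢ B, ENNReal.ofReal (K (p.1 - p.2)) := by
  rw [Measure.volume_eq_prod, ← Measure.prod_restrict,
    lintegral_prod _ (measurable_kernel_sub hK).aemeasurable]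
  rfl

/-- The three interactions live on disjoint sets of pairs. Written as one integral, the perimeters
of different sets can be compared pair by pair. -/
theorem perimeterIn_eq_setLIntegral_crossing (hK : Measurable K) {Ω E : Set (Space n)}
    (hΩ : MeasurableSet Ω) (hE : MeasurableSet E) :
    perimeterIn K Ω E = ∫⁻ p in crossing Ω E, ENNReal.ofReal (K (p.1 - p.2)) := by
  unfold perimeterIn
  simp only [interaction_eq_setLIntegral_prod hK]
  rw [← lintegral_union ((hE.inter hΩ).prod (hE.compl.diff hΩ)),
    ← lintegral_union ((hE.diff hΩ).prod (hE.compl.inter hΩ))]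
  · congr 2
    ext p
    simp only [crossing, mem_union, mem_prod, mem_inter_iff, mem_sdiff, mem_compl_iff,
      mem_ofPred_eq]
    tauto
  · rw [Set.disjoint_left]
    rintro p (hp | hp) hp' <;> exact hp'.1.2 hp.1.2
  · rw [Set.disjoint_left]
    rintro p hp hp'
    exact hp'.2.2 hp.2.2

/-- The strong submodularity of the nonlocal perimeter. -/
theorem perimeterIn_union_add_inter_le (hK : Measurable K) {Ω E F : Set (Space n)}
    (hΩ : MeasurableSet Ω) (hE : MeasurableSet E) (hF : MeasurableSet F) (hsub : F \ E ⊆ Ω) :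
    perimeterIn K Ω (E ∪ F) + perimeterIn K Ω (E ∩ F) + interaction K (F \ E) (E \ F) ≤
      perimeterIn K Ω E + perimeterIn K Ω F := by
  rw [perimeterIn_eq_setLIntegral_crossing hK hΩ (hE.union hF),
    perimeterIn_eq_setLIntegral_crossing hK hΩ (hE.inter hF),
    perimeterIn_eq_setLIntegral_crossing hK hΩ hE, perimeterIn_eq_setLIntegral_crossing hK hΩ hF,
    interaction_eq_setLIntegral_prod hK]
  have hk := measurable_kernel_sub hK
  rw [← lintegral_indicator (measurableSet_crossing hΩ (hE.union hF)),
    ← lintegral_indicator (measurableSet_crossing hΩ (hE.inter hF)),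
    ← lintegral_indicator (measurableSet_crossing hΩ hE),
    ← lintegral_indicator (measurableSet_crossing hΩ hF),
    ← lintegral_indicator ((hF.diff hE).prod (hE.diff hF)),
    ← lintegral_add_left (hk.indicator (measurableSet_crossing hΩ (hE.union hF))),
    ← lintegral_add_right _ (hk.indicator ((hF.diff hE).prod (hE.diff hF))),
    ← lintegral_add_left (hk.indicator (measurableSet_crossing hΩ hE))]
  -- The inequality holds for each pair. A pair in `(F \ E) × (E \ F)` crosses neither the union nor
  -- the intersection, but it crosses `F`, with first point in `Ω` by `hsub`; this pays for the
  -- extra interaction.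
  refine lintegral_mono fun p => ?_
  have h1 := @hsub p.1
  by_cases a : p.1 ∈ E <;> by_cases b : p.1 ∈ F <;> by_cases c : p.2 ∈ E <;>
    by_cases d : p.2 ∈ F <;> by_cases e : p.1 ∈ Ω ∨ p.2 ∈ Ω <;>
    simp_all [indicator, crossing]

theorem perimeterIn_le_perimeter (Ω E : Set (Space n)) :
    perimeterIn K Ω (E ∪ Ω) ≤ perimeter K Ω := by
  unfold perimeterIn perimeter
  have h1 : (E ∪ Ω)ᶜ ∩ Ω = ∅ := by ext x; simp
  rw [h1]
  have h2 : ∀ A : Set (Space n), interaction K A ∅ = 0 := fun A => by simp [interaction]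
  rw [h2, h2, zero_add, add_zero]
  exact interaction_mono inter_subset_right fun x hx => hx.2

/-- The deformation of the identity along the constant direction `v` with profile `φ`. -/
def deform (φ : Space n → ℝ) (v : Space n) (t : ℝ) (x : Space n) : Space n :=
  x + (t * φ x) • v

section deform

variable {φ : Space n → ℝ} {v : Space n} {t : ℝ} {L : NNReal}

theorem deform_of_eq_zero {x : Space n} (hx : φ x = 0) : deform φ v t x = x := by
  simp [deform, hx]

theorem deform_sub (x y : Space n) :
    deform φ v t x - deform φ v t y = (x - y) + (t * (φ x - φ y)) • v := by
  simp only [deform]; module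

theorem abs_sub_le_of_lipschitz (hφ : LipschitzWith L φ) (x y : Space n) :
    |φ x - φ y| ≤ L * ‖x - y‖ := by
  simpa [Real.norm_eq_abs] using hφ.norm_sub_le x y

theorem deform_injective (hφ : LipschitzWith L φ) (hv : ‖v‖ = 1) (ht : |t| * L ≤ 1 / 2) :
    Function.Injective (deform φ v t) := by
  intro x y hxy
  have h := deform_sub (φ := φ) (v := v) (t := t) x y
  rw [hxy, sub_self] at h
  have h1 : ‖x - y‖ = |t| * |φ x - φ y| := by
    rw [eq_neg_of_add_eq_zero_left h.symm, norm_neg, norm_smul, hv, mul_one, Real.norm_eq_abs,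
      abs_mul]
  have h2 : |t| * |φ x - φ y| ≤ |t| * (L * ‖x - y‖) :=
    mul_le_mul_of_nonneg_left (abs_sub_le_of_lipschitz hφ x y) (abs_nonneg t)
  have h3 : ‖x - y‖ ≤ 0 := by nlinarith [norm_nonneg (x - y)]
  exact sub_eq_zero.1 (norm_le_zero_iff.1 h3)

/-- A preimage of `y` is a fixed point of `x ↦ y - t φ(x) v`, a contraction of ratio `1/2`. -/
theorem deform_surjective (hφ : LipschitzWith L φ) (hv : ‖v‖ = 1) (ht : |t| * L ≤ 1 / 2) :
    Function.Surjective (deform φ v t) := by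
  intro y
  have hc : ContractingWith (1 / 2) fun x => y - (t * φ x) • v := by
    refine ⟨by rw [← NNReal.coe_lt_coe]; norm_num, LipschitzWith.of_dist_le_mul fun a b => ?_⟩
    rw [dist_eq_norm, dist_eq_norm]
    have e : y - (t * φ a) • v - (y - (t * φ b) • v) = (t * (φ b - φ a)) • v := by module
    rw [e, norm_smul, hv, mul_one, Real.norm_eq_abs, abs_mul, norm_sub_rev]
    have h2 : |t| * |φ b - φ a| ≤ |t| * (L * ‖b - a‖) :=
      mul_le_mul_of_nonneg_left (abs_sub_le_of_lipschitz hφ b a) (abs_nonneg t)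
    push_cast
    nlinarith [norm_nonneg (b - a)]
  refine ⟨hc.fixedPoint, ?_⟩
  have := hc.fixedPoint_isFixedPt
  simp only [Function.IsFixedPt] at this
  simp only [deform]
  nth_rewrite 1 [← this]
  exact sub_add_cancel _ _

theorem deform_mem_iff (hφ : LipschitzWith L φ) (hv : ‖v‖ = 1) (ht : |t| * L ≤ 1 / 2)
    {Ω : Set (Space n)} (hΩ : ∀ x ∉ Ω, φ x = 0) (x : Space n) : deform φ v t x ∈ Ω ↔ x ∈ Ω := by
  constructor
  · intro h
    by_contra hx
    rw [deform_of_eq_zero (hΩ x hx)] at h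
    exact hx h
  · intro h
    by_contra hx
    have := deform_injective hφ hv ht (deform_of_eq_zero (v := v) (t := t) (hΩ _ hx))
    rw [this] at hx
    exact hx h

theorem abs_fderiv_apply_le (hφ : LipschitzWith L φ) (hv : ‖v‖ = 1) (x : Space n) :
    |fderiv ℝ φ x v| ≤ L := by
  have := (fderiv ℝ φ x).le_of_opNorm_le (norm_fderiv_le_of_lipschitz ℝ hφ (x₀ := x)) v
  rwa [hv, mul_one, Real.norm_eq_abs] at this

theorem jacobian_pos (hφ : LipschitzWith L φ) (hv : ‖v‖ = 1) (ht : |t| * L ≤ 1 / 2)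
    (x : Space n) : 0 < 1 + t * fderiv ℝ φ x v := by
  have h1 : |t * fderiv ℝ φ x v| ≤ |t| * L := by
    rw [abs_mul]
    exact mul_le_mul_of_nonneg_left (abs_fderiv_apply_le hφ hv x) (abs_nonneg t)
  linarith [neg_abs_le (t * fderiv ℝ φ x v)]

theorem hasFDerivAt_deform (hd : Differentiable ℝ φ) (x : Space n) :
    HasFDerivAt (deform φ v t)
      (ContinuousLinearMap.id ℝ (Space n) + (t • fderiv ℝ φ x).smulRight v) x :=
  (hasFDerivAt_id x).add (((hd x).hasFDerivAt.const_mul t).smul_const v)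

theorem det_id_add_smulRight (f : Space n →L[ℝ] ℝ) (v : Space n) :
    (ContinuousLinearMap.id ℝ (Space n) + f.smulRight v).det = 1 + f v :=
  LinearMap.transvection.det (f : Space n →ₗ[ℝ] ℝ) v

theorem continuous_deform (hd : Differentiable ℝ φ) : Continuous (deform φ v t) := by
  unfold deform
  have := hd.continuous
  fun_prop

/-- The differential is a rank-one perturbation of the identity, so its determinant is exactly `1 +
t ∂_v φ`, positive because `|t| L ≤ 1/2`. -/
theorem map_deform_withDensity (hφ : LipschitzWith L φ) (hd : Differentiable ℝ φ) (hv : ‖v‖ = 1)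
    (ht : |t| * L ≤ 1 / 2) :
    Measure.map (deform φ v t)
      (volume.withDensity fun x => ENNReal.ofReal (1 + t * fderiv ℝ φ x v)) = volume := by
  have h := map_withDensity_abs_det_fderiv_eq_addHaar (volume : Measure (Space n))
    MeasurableSet.univ.nullMeasurableSet
    (fun x _ => (hasFDerivAt_deform (v := v) (t := t) hd x).hasFDerivWithinAt)
    (deform_injective hφ hv ht).injOn
  rw [image_univ, (deform_surjective hφ hv ht).range_eq, Measure.restrict_univ] at h
  have e : (fun x => ENNReal.ofReal (1 + t * fderiv ℝ φ x v)) = fun x => ENNReal.ofReal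
      |(ContinuousLinearMap.id ℝ (Space n) + (t • fderiv ℝ φ x).smulRight v).det| := by
    funext x
    rw [det_id_add_smulRight, smul_apply, smul_eq_mul,
      abs_of_pos (jacobian_pos hφ hv ht x)]
  rw [e]
  exact h

theorem lintegral_prod_deform (hφ : LipschitzWith L φ) (hd : ContDiff ℝ 1 φ) (hv : ‖v‖ = 1)
    (ht : |t| * L ≤ 1 / 2) {G : Space n × Space n → ℝ≥0∞} (hG : Measurable G) :
    ∫⁻ p, G p = ∫⁻ p : Space n × Space n,
      ENNReal.ofReal ((1 + t * fderiv ℝ φ p.1 v) * (1 + t * fderiv ℝ φ p.2 v)) *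
        G (deform φ v t p.1, deform φ v t p.2) := by
  have hdiff : Differentiable ℝ φ := hd.differentiable one_ne_zero
  have hcont : Continuous fun x => fderiv ℝ φ x v :=
    (hd.continuous_fderiv one_ne_zero).clm_apply continuous_const
  have hJ : Measurable fun x : Space n => ENNReal.ofReal (1 + t * fderiv ℝ φ x v) :=
    (continuous_const.add (continuous_const.mul hcont)).measurable.ennreal_ofReal
  have hΦ : Measurable (deform φ v t) := (continuous_deform hdiff).measurable
  have hmap := map_deform_withDensity hφ hdiff hv ht
  have hprod : (volume : Measure (Space n × Space n)) =
      Measure.map (Prod.map (deform φ v t) (deform φ v t))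
        ((volume : Measure (Space n × Space n)).withDensity fun p =>
          ENNReal.ofReal (1 + t * fderiv ℝ φ p.1 v) *
            ENNReal.ofReal (1 + t * fderiv ℝ φ p.2 v)) := by
    rw [Measure.volume_eq_prod, ← prod_withDensity hJ hJ, ← Measure.map_prod_map _ _ hΦ hΦ, hmap]
  conv_lhs => rw [hprod]
  have hJ2 : Measurable fun p : Space n × Space n =>
      ENNReal.ofReal (1 + t * fderiv ℝ φ p.1 v) * ENNReal.ofReal (1 + t * fderiv ℝ φ p.2 v) :=
    (hJ.comp measurable_fst).mul (hJ.comp measurable_snd)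
  rw [lintegral_map hG (hΦ.prodMap hΦ), lintegral_withDensity_eq_lintegral_mul _ hJ2
    (g := fun p => G (Prod.map (deform φ v t) (deform φ v t) p)) (hG.comp (hΦ.prodMap hΦ))]
  refine lintegral_congr fun p => ?_
  rw [Pi.mul_apply, ENNReal.ofReal_mul (jacobian_pos hφ hv ht p.1).le]
  rfl

theorem measurableSet_image_deform (hφ : LipschitzWith L φ) (hd : Differentiable ℝ φ)
    (hv : ‖v‖ = 1) (ht : |t| * L ≤ 1 / 2) {E : Set (Space n)} (hE : MeasurableSet E) :
    MeasurableSet (deform φ v t '' E) :=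
  hE.image_of_continuousOn_injOn (continuous_deform hd).continuousOn
    (deform_injective hφ hv ht).injOn

theorem perimeterIn_image_deform (hK : Measurable K) (hφ : LipschitzWith L φ)
    (hd : ContDiff ℝ 1 φ) (hv : ‖v‖ = 1) (ht : |t| * L ≤ 1 / 2) {Ω E : Set (Space n)}
    (hΩm : MeasurableSet Ω) (hΩ : ∀ x ∉ Ω, φ x = 0) (hE : MeasurableSet E) :
    perimeterIn K Ω (deform φ v t '' E) = ∫⁻ p in crossing Ω E,
      ENNReal.ofReal ((1 + t * fderiv ℝ φ p.1 v) * (1 + t * fderiv ℝ φ p.2 v)) *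
        ENNReal.ofReal (K (p.1 - p.2 + (t * (φ p.1 - φ p.2)) • v)) := by
  have hEt := measurableSet_image_deform hφ (hd.differentiable one_ne_zero) hv ht hE
  rw [perimeterIn_eq_setLIntegral_crossing hK hΩm hEt,
    ← lintegral_indicator (measurableSet_crossing hΩm hEt),
    lintegral_prod_deform hφ hd hv ht ((measurable_kernel_sub hK).indicator
      (measurableSet_crossing hΩm hEt)),
    ← lintegral_indicator (measurableSet_crossing hΩm hE)]
  refine lintegral_congr fun p => ?_
  have hmem : (deform φ v t p.1, deform φ v t p.2) ∈ crossing Ω (deform φ v t '' E) ↔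
      p ∈ crossing Ω E := by
    simp only [crossing, mem_ofPred_eq, (deform_injective hφ hv ht).mem_set_image,
      deform_mem_iff hφ hv ht hΩ]
  by_cases hp : p ∈ crossing Ω E
  · rw [indicator_of_mem hp, indicator_of_mem (hmem.2 hp), deform_sub]
  · rw [indicator_of_notMem hp, indicator_of_notMem (fun h => hp (hmem.1 h)), mul_zero]

end deform

end

/-! ### Second variation and minimality -/

section

variable {n : ℕ} {K Kstar : Space n → ℝ} {C₁ R₀ ρ : ℝ} {φ : Space n → ℝ} {v : Space n} {t : ℝ}
  {L : NNReal} {Ω E : Set (Space n)}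

/-- Controls the contribution of the term `χ_{|z| < R₀}` in the controlling kernel: a pair at
distance below `R₀` with one point in `B_ρ` lies in `B_{ρ+R₀}`. -/
theorem volume_crossing_inter_le (hΩ : Ω ⊆ ball 0 ρ) :
    volume (crossing Ω E ∩ {p | ‖p.1 - p.2‖ < R₀}) ≤ volume (ball (0 : Space n) (ρ + R₀)) ^ 2 := by
  rw [sq, ← Measure.prod_prod, ← Measure.volume_eq_prod]
  refine measure_mono ?_
  rintro p ⟨⟨-, -, hp⟩, hd⟩
  rw [mem_ofPred_eq] at hd
  have h1 := norm_sub_norm_le p.1 p.2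
  have h2 := norm_sub_norm_le p.2 p.1
  rw [norm_sub_rev p.2] at h2
  rw [mem_prod, mem_ball_zero_iff, mem_ball_zero_iff]
  rcases hp with hp | hp <;> have hp' := mem_ball_zero_iff.1 (hΩ hp) <;> constructor <;> linarith

theorem IsAdmissible.deformed_kernel_sum_le (hK : IsAdmissible K (controlKernel K C₁ R₀))
    (hC : 0 ≤ C₁) (hφ : LipschitzWith L φ) (hv : ‖v‖ = 1) (ht : |t| * L ≤ 1 / 2)
    {x y : Space n} (hxy : x ≠ y) :
    ENNReal.ofReal ((1 + t * fderiv ℝ φ x v) * (1 + t * fderiv ℝ φ y v)) *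
        ENNReal.ofReal (K (x - y + (t * (φ x - φ y)) • v)) +
      ENNReal.ofReal ((1 + -t * fderiv ℝ φ x v) * (1 + -t * fderiv ℝ φ y v)) *
        ENNReal.ofReal (K (x - y + (-t * (φ x - φ y)) • v)) ≤
      ENNReal.ofReal (2 + t ^ 2 * L ^ 2 * (11 * C₁ + 2)) * ENNReal.ofReal (K (x - y)) +
        {p : Space n × Space n | ‖p.1 - p.2‖ < R₀}.indicator
          (fun _ => ENNReal.ofReal (t ^ 2 * L ^ 2 * (11 * C₁))) (x, y) := by
  have hz : x - y ≠ 0 := sub_ne_zero.2 hxy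
  have ht' : |-t| * L ≤ 1 / 2 := by rwa [abs_neg]
  have hJ : ∀ s : ℝ, |s| * L ≤ 1 / 2 →
      0 ≤ (1 + s * fderiv ℝ φ x v) * (1 + s * fderiv ℝ φ y v) := fun s hs =>
    (mul_pos (jacobian_pos hφ hv hs x) (jacobian_pos hφ hv hs y)).le
  have hne : ∀ s : ℝ, |s| * L ≤ 1 / 2 → x - y + (s * (φ x - φ y)) • v ≠ 0 := by
    intro s hs h0
    rw [← deform_sub, sub_eq_zero] at h0
    exact hxy (deform_injective hφ hv hs h0)
  have hmain := hK.weighted_second_variation_le (t := t) hv hz L.2 (abs_fderiv_apply_le hφ hv x)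
    (abs_fderiv_apply_le hφ hv y) (abs_sub_le_of_lipschitz hφ x y) ht
  rw [← ENNReal.ofReal_mul (hJ t ht), ← ENNReal.ofReal_mul (hJ (-t) ht'),
    ← ENNReal.ofReal_add (mul_nonneg (hJ t ht) (hK.nonneg _ (hne t ht)))
      (mul_nonneg (hJ (-t) ht') (hK.nonneg _ (hne (-t) ht')))]
  have hind : {p : Space n × Space n | ‖p.1 - p.2‖ < R₀}.indicator
      (fun _ => ENNReal.ofReal (t ^ 2 * L ^ 2 * (11 * C₁))) (x, y) =
      ENNReal.ofReal (t ^ 2 * L ^ 2 * (11 * C₁) *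
        indicator {w : Space n | ‖w‖ < R₀} (fun _ => (1 : ℝ)) (x - y)) := by
    by_cases h : ‖x - y‖ < R₀ <;> simp [indicator, h]
  rw [hind, ← ENNReal.ofReal_mul (by positivity), ← ENNReal.ofReal_add]
  · refine ENNReal.ofReal_le_ofReal ?_
    unfold controlKernel at hmain
    have e1 : x - y + (-t * (φ x - φ y)) • v = x - y - (t * (φ x - φ y)) • v := by module
    rw [e1]
    refine (le_of_eq ?_).trans (hmain.trans (le_of_eq ?_))
    · ring
    · simp only [NNReal.val_eq_coe]; ring
  · exact mul_nonneg (by positivity) (hK.nonneg _ hz)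
  · exact mul_nonneg (by positivity) (indicator_nonneg (fun _ _ => zero_le_one) _)

/-- The second variation of the nonlocal perimeter along a deformation. -/
theorem IsAdmissible.second_variation_le (hK : IsAdmissible K (controlKernel K C₁ R₀))
    (hC : 0 ≤ C₁) (hφ : LipschitzWith L φ) (hd : ContDiff ℝ 1 φ) (hv : ‖v‖ = 1)
    (ht : |t| * L ≤ 1 / 2) (hΩm : MeasurableSet Ω) (hΩρ : Ω ⊆ ball 0 ρ) (hΩ : ∀ x ∉ Ω, φ x = 0)
    (hE : MeasurableSet E) :
    perimeterIn K Ω (deform φ v t '' E) + perimeterIn K Ω (deform φ v (-t) '' E) ≤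
      2 * perimeterIn K Ω E + ENNReal.ofReal (t ^ 2) * (ENNReal.ofReal (L ^ 2 * (11 * C₁ + 2)) *
        perimeterIn K Ω E + ENNReal.ofReal (L ^ 2 * (11 * C₁)) *
          volume (ball (0 : Space n) (ρ + R₀)) ^ 2) := by
  have ht' : |-t| * L ≤ 1 / 2 := by rwa [abs_neg]
  have hcr := measurableSet_crossing hΩm hE
  have hk := measurable_kernel_sub hK.measurable
  have hnear : MeasurableSet {p : Space n × Space n | ‖p.1 - p.2‖ < R₀} :=
    measurableSet_lt (measurable_fst.sub measurable_snd).norm measurable_const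
  have hφc : Continuous φ := hd.continuous
  have hφ' : Continuous fun x => fderiv ℝ φ x v :=
    (hd.continuous_fderiv one_ne_zero).clm_apply continuous_const
  have hmeas : Measurable fun p : Space n × Space n =>
      ENNReal.ofReal ((1 + t * fderiv ℝ φ p.1 v) * (1 + t * fderiv ℝ φ p.2 v)) *
        ENNReal.ofReal (K (p.1 - p.2 + (t * (φ p.1 - φ p.2)) • v)) := by
    refine Measurable.mul (Continuous.measurable ?_).ennreal_ofReal
      (hK.measurable.comp (Continuous.measurable ?_)).ennreal_ofReal
    · have h1 := hφ'.comp (continuous_fst (X := Space n) (Y := Space n))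
      have h2 := hφ'.comp (continuous_snd (X := Space n) (Y := Space n))
      exact (continuous_const.add (continuous_const.mul h1)).mul
        (continuous_const.add (continuous_const.mul h2))
    · fun_prop
  rw [perimeterIn_image_deform hK.measurable hφ hd hv ht hΩm hΩ hE,
    perimeterIn_image_deform hK.measurable hφ hd hv ht' hΩm hΩ hE,
    perimeterIn_eq_setLIntegral_crossing hK.measurable hΩm hE, ← lintegral_add_left hmeas]
  calc _ ≤ ∫⁻ p in crossing Ω E,
        (ENNReal.ofReal (2 + t ^ 2 * L ^ 2 * (11 * C₁ + 2)) * ENNReal.ofReal (K (p.1 - p.2)) +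
        {p : Space n × Space n | ‖p.1 - p.2‖ < R₀}.indicator
          (fun _ => ENNReal.ofReal (t ^ 2 * L ^ 2 * (11 * C₁))) p) := by
        refine setLIntegral_mono' hcr fun p hp => ?_
        refine hK.deformed_kernel_sum_le hC hφ hv ht fun h => ?_
        exact hp.2.1 (h ▸ hp.1)
    _ = ENNReal.ofReal (2 + t ^ 2 * L ^ 2 * (11 * C₁ + 2)) *
          (∫⁻ p in crossing Ω E, ENNReal.ofReal (K (p.1 - p.2))) +
        ENNReal.ofReal (t ^ 2 * L ^ 2 * (11 * C₁)) *
          volume (crossing Ω E ∩ {p | ‖p.1 - p.2‖ < R₀}) := by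
        rw [lintegral_add_left (hk.const_mul _), lintegral_const_mul _ hk,
          lintegral_indicator_const hnear, Measure.restrict_apply hnear, inter_comm]
    _ ≤ ENNReal.ofReal (2 + t ^ 2 * L ^ 2 * (11 * C₁ + 2)) *
          (∫⁻ p in crossing Ω E, ENNReal.ofReal (K (p.1 - p.2))) +
        ENNReal.ofReal (t ^ 2 * L ^ 2 * (11 * C₁)) *
          volume (ball (0 : Space n) (ρ + R₀)) ^ 2 := by
        gcongr
        exact volume_crossing_inter_le hΩρ
    _ = _ := by
        rw [ENNReal.ofReal_add zero_le_two (by positivity), mul_assoc (t ^ 2), mul_assoc (t ^ 2),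
          ENNReal.ofReal_mul (sq_nonneg t), ENNReal.ofReal_mul (p := t ^ 2) (sq_nonneg t),
          ENNReal.ofReal_ofNat]
        ring

theorem image_deform_sdiff_eq (hφ : LipschitzWith L φ) (hv : ‖v‖ = 1) (ht : |t| * L ≤ 1 / 2)
    (hΩ : ∀ x ∉ Ω, φ x = 0) : deform φ v t '' E \ Ω = E \ Ω := by
  ext x
  simp only [mem_sdiff]
  refine and_congr_left fun hx => ?_
  conv_lhs => rw [← deform_of_eq_zero (v := v) (t := t) (hΩ x hx)]
  exact (deform_injective hφ hv ht).mem_set_image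

theorem sdiff_subset_of_sdiff_eq {α : Type*} {E F Ω : Set α} (h : F \ Ω = E \ Ω) :
    F \ E ⊆ Ω := by
  intro x hx
  by_contra hxΩ
  have : x ∈ E \ Ω := h ▸ ⟨hx.1, hxΩ⟩
  exact hx.2 this.1

/-- A minimizer interacts little across its symmetric difference with a deformation of it. -/
theorem IsAdmissible.interaction_deform_le (hK : IsAdmissible K (controlKernel K C₁ R₀))
    (hC : 0 ≤ C₁) (hφ : LipschitzWith L φ) (hd : ContDiff ℝ 1 φ) (hv : ‖v‖ = 1)
    (ht : |t| * L ≤ 1 / 2) (hΩm : MeasurableSet Ω) (hΩρ : Ω ⊆ ball 0 ρ) (hΩ : ∀ x ∉ Ω, φ x = 0)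
    (hE : MeasurableSet E) (hmin : IsMinimizer K Ω E) :
    interaction K (deform φ v t '' E \ E) (E \ deform φ v t '' E) ≤
      ENNReal.ofReal (t ^ 2) * (ENNReal.ofReal (L ^ 2 * (11 * C₁ + 2)) *
        perimeterIn K Ω E + ENNReal.ofReal (L ^ 2 * (11 * C₁)) *
          volume (ball (0 : Space n) (ρ + R₀)) ^ 2) := by
  have ht' : |-t| * L ≤ 1 / 2 := by rwa [abs_neg]
  have hdiff : Differentiable ℝ φ := hd.differentiable one_ne_zero
  set F := deform φ v t '' E with hF
  have hFm : MeasurableSet F := measurableSet_image_deform hφ hdiff hv ht hE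
  have hF'm : MeasurableSet (deform φ v (-t) '' E) :=
    measurableSet_image_deform hφ hdiff hv ht' hE
  have hFΩ : F \ Ω = E \ Ω := image_deform_sdiff_eq hφ hv ht hΩ
  have hsub := perimeterIn_union_add_inter_le hK.measurable hΩm hE hFm
    (sdiff_subset_of_sdiff_eq hFΩ)
  have h1 : perimeterIn K Ω E ≤ perimeterIn K Ω (E ∪ F) :=
    hmin.le _ (hE.union hFm).nullMeasurableSet (by rw [union_sdiff_distrib, hFΩ, union_self])
  have h2 : perimeterIn K Ω E ≤ perimeterIn K Ω (E ∩ F) :=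
    hmin.le _ (hE.inter hFm).nullMeasurableSet (by
      rw [sdiff_eq, inter_inter_distrib_right, ← sdiff_eq, ← sdiff_eq, hFΩ, inter_self])
  have h3 : perimeterIn K Ω E ≤ perimeterIn K Ω (deform φ v (-t) '' E) :=
    hmin.le _ hF'm.nullMeasurableSet (image_deform_sdiff_eq hφ hv ht' hΩ)
  have h4 := hK.second_variation_le hC hφ hd hv ht hΩm hΩρ hΩ hE
  set P := perimeterIn K Ω E with hP
  have hfin : P ≠ ∞ := hmin.finite.ne
  set I := interaction K (F \ E) (E \ F)
  -- Submodularity, with union and intersection both bounded below by `P`; the finite `P` cancels.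
  -- Adding `P ≤ P(E_{-t})` then gives `2P + I` below the second-variation sum.
  have h5 : P + I ≤ perimeterIn K Ω F := by
    refine (ENNReal.add_le_add_iff_left hfin).1 ?_
    rw [← add_assoc]
    exact le_trans (by gcongr) hsub
  refine (ENNReal.add_le_add_iff_left (ENNReal.mul_ne_top ENNReal.ofNat_ne_top hfin)).1
    (le_trans ?_ h4)
  calc 2 * P + I = P + I + P := by ring
    _ ≤ _ := by gcongr

end

/-! ### From small interaction to a bound on the perimeter -/

section

variable {n : ℕ} {K Kstar : Space n → ℝ} {C₁ R₀ ρ : ℝ} {φ : Space n → ℝ} {v w : Space n} {t : ℝ}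
  {L : NNReal} {Ω E : Set (Space n)}

/-- The points of the unit ball which `E` gains when it is translated by `w`. -/
def gain (E : Set (Space n)) (w : Space n) : Set (Space n) :=
  {x | x ∈ ball 0 1 ∧ x - w ∈ E ∧ x ∉ E}

theorem measurableSet_gain (hE : MeasurableSet E) (w : Space n) : MeasurableSet (gain E w) :=
  measurableSet_ball.inter (((measurable_id.sub_const w) hE).inter hE.compl)

theorem volume_gain_lt_top (E : Set (Space n)) (w : Space n) : volume (gain E w) < ∞ :=
  (measure_mono fun _ hx => hx.1).trans_lt (measure_ball_lt_top (x := (0 : Space n)) (r := 1))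

/-- The gains of `E` and of its complement differ by `|(E + w) ∩ B_1| - |E ∩ B_1|`. Translation
invariance reduces this to the part of `B_1` whose translate by `-w` leaves `B_1`. -/
theorem volume_gain_le (hn : 1 ≤ n) (hE : MeasurableSet E) (w : Space n) :
    volume (gain E w) ≤ volume (gain Eᶜ w) +
      volume (ball (0 : Space n) 1) * ENNReal.ofReal (n * ‖w‖) := by
  set S : Set (Space n) := {x | x ∈ ball 0 1 ∧ x - w ∈ E ∧ x ∈ E} with hS
  have hSm : MeasurableSet S :=
    measurableSet_ball.inter (((measurable_id.sub_const w) hE).inter hE)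
  have hSfin : volume S ≠ ∞ :=
    ((measure_mono fun _ hx => hx.1).trans_lt
      (measure_ball_lt_top (x := (0 : Space n)) (r := 1))).ne
  have h1 : volume (gain E w) + volume S ≤ volume {x : Space n | x ∈ ball 0 1 ∧ x - w ∈ E} := by
    rw [← measure_union _ hSm]
    · exact measure_mono fun x hx => by rcases hx with hx | hx <;> exact ⟨hx.1, hx.2.1⟩
    · rw [Set.disjoint_left]; exact fun x hx hx' => hx.2.2 hx'.2.2
  have h2 : volume {x : Space n | x ∈ ball 0 1 ∧ x - w ∈ E} ≤ volume (ball 0 1 ∩ E) +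
      volume {x : Space n | x ∈ ball 0 1 ∧ x - w ∉ ball 0 1} := by
    calc _ ≤ volume ((fun x => x - w) ⁻¹' (ball 0 1 ∩ E) ∪
          {x : Space n | x ∈ ball 0 1 ∧ x - w ∉ ball 0 1}) := measure_mono fun x hx => by
          by_cases h : x - w ∈ ball 0 1
          · exact Or.inl ⟨h, hx.2⟩
          · exact Or.inr ⟨hx.1, h⟩
      _ ≤ _ := measure_union_le _ _
      _ = _ := by
        rw [(measurePreserving_sub_right volume w).measure_preimage
          (measurableSet_ball.inter hE).nullMeasurableSet]
  have h3 : volume (ball 0 1 ∩ E) ≤ volume (gain Eᶜ w) + volume S := by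
    refine (measure_mono fun x hx => ?_).trans (measure_union_le _ _)
    by_cases h : x - w ∈ E
    · exact Or.inr ⟨hx.1, h, hx.2⟩
    · exact Or.inl ⟨hx.1, h, fun h' => h' hx.2⟩
  have h4 := volume_ball_inter_shift_le hn one_pos w
  rw [div_one] at h4
  refine (ENNReal.add_le_add_iff_right hSfin).1 ?_
  calc _ ≤ _ := h1
    _ ≤ _ := h2
    _ ≤ volume (gain Eᶜ w) + volume S +
      volume (ball (0 : Space n) 1) * ENNReal.ofReal (n * ‖w‖) := by gcongr
    _ = _ := by ring

/-- The smaller of `a`, `b` is at most `s`, and the larger exceeds it by at most `d`. -/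
theorem add_le_of_mul_le_sq {a b s d : ℝ} (ha : 0 ≤ a) (hb : 0 ≤ b) (hs : 0 ≤ s)
    (h : a * b ≤ s ^ 2) (hab : a ≤ b + d) (hba : b ≤ a + d) : a + b ≤ 2 * s + d := by
  rcases le_total a b with hle | hle
  · have : a ≤ s := by nlinarith
    linarith
  · have : b ≤ s := by nlinarith
    linarith

theorem mem_image_deform_iff (hφ : LipschitzWith L φ) (hv : ‖v‖ = 1) (ht : |t| * L ≤ 1 / 2)
    (hφ1 : ∀ x ∈ ball (0 : Space n) 2, φ x = 1) (ht1 : |t| ≤ 1) {x : Space n}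
    (hx : x ∈ ball 0 1) : x ∈ deform φ v t '' E ↔ x - t • v ∈ E := by
  have hxt : x - t • v ∈ ball (0 : Space n) 2 := by
    rw [mem_ball_zero_iff] at hx ⊢
    have h1 := norm_sub_le x (t • v)
    rw [norm_smul, hv, mul_one, Real.norm_eq_abs] at h1
    linarith
  have e : deform φ v t (x - t • v) = x := by simp [deform, hφ1 _ hxt]
  conv_lhs => rw [← e]
  exact (deform_injective hφ hv ht).mem_set_image

theorem IsAdmissible.volume_gain_mul_le (hK : IsAdmissible K Kstar) (hφ : LipschitzWith L φ)
    (hv : ‖v‖ = 1) (ht : |t| * L ≤ 1 / 2) (hφ1 : ∀ x ∈ ball (0 : Space n) 2, φ x = 1)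
    (ht1 : |t| ≤ 1) (hE : MeasurableSet E) :
    volume (gain E (t • v)) * volume (gain Eᶜ (t • v)) ≤
      interaction K (deform φ v t '' E \ E) (E \ deform φ v t '' E) := by
  refine (hK.volume_mul_le_interaction (measurableSet_gain hE _)
    (measurableSet_gain hE.compl _) ?_ ?_).trans (interaction_mono ?_ ?_)
  · rw [Set.disjoint_left]; exact fun x hx hx' => hx'.2.1 hx.2.1
  · intro x hx y hy
    have h1 := mem_ball_zero_iff.1 hx.1
    have h2 := mem_ball_zero_iff.1 hy.1
    linarith [norm_sub_le x y]
  · exact fun x hx => ⟨(mem_image_deform_iff hφ hv ht hφ1 ht1 hx.1).2 hx.2.1, hx.2.2⟩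
  · exact fun x hx => ⟨not_not.1 hx.2.2,
      fun h => hx.2.1 ((mem_image_deform_iff hφ hv ht hφ1 ht1 hx.1).1 h)⟩

open Filter Topology in
/-- A bound on the translations of `E` by multiples of `v` bounds the distributional derivative of
its characteristic function in the direction `v`. -/
theorem setIntegral_indicator_mul_fderiv_le {M t₀ : ℝ} (hE : MeasurableSet E) (hv : ‖v‖ = 1)
    (ht₀ : 0 < t₀)
    (hM : ∀ t, 0 < t → t < t₀ →
      volume.real (gain E (t • v)) + volume.real (gain Eᶜ (t • v)) ≤ t * M)
    {f : Space n → ℝ} (hf : ContDiff ℝ 1 f) (hfc : HasCompactSupport f)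
    (hfs : tsupport f ⊆ ball 0 1) (hf1 : ∀ x, |f x| ≤ 1) :
    ∫ x in ball 0 1, E.indicator (fun _ => (1 : ℝ)) x * fderiv ℝ f x v ≤ M := by
  obtain ⟨C, hC⟩ := hf.lipschitzWith_of_hasCompactSupport hfc one_ne_zero
  -- Truncating to `B_2` makes the indicator integrable and changes nothing where it is used: `f` is
  -- supported in `B_1` and the shifts have length below `1`.
  set g : Space n → ℝ := (E ∩ ball 0 2).indicator fun _ => 1 with hg
  have hgint : Integrable g volume :=
    (integrable_indicator_iff (hE.inter measurableSet_ball)).2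
      (integrableOn_const ((measure_mono inter_subset_right).trans_lt measure_ball_lt_top).ne)
  have hf0 : ∀ x ∉ ball (0 : Space n) 1, f x = 0 := fun x hx =>
    image_eq_zero_of_notMem_tsupport fun h => hx (hfs h)
  have hfint : Integrable f volume := hf.continuous.integrable_of_hasCompactSupport hfc
  have hlim := hC.integral_inv_smul_sub_mul_tendsto_integral_lineDeriv_mul hgint v
  have heq : ∫ x, lineDeriv ℝ f x v * g x =
      ∫ x in ball 0 1, E.indicator (fun _ => (1 : ℝ)) x * fderiv ℝ f x v := by
    rw [← setIntegral_eq_integral_of_forall_compl_eq_zero (s := ball 0 1)]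
    · refine setIntegral_congr_fun measurableSet_ball fun x hx => ?_
      have hx2 : x ∈ ball (0 : Space n) 2 := ball_subset_ball one_le_two hx
      have hgx : g x = E.indicator (fun _ => (1 : ℝ)) x := by
        by_cases hxE : x ∈ E <;> simp only [hg, indicator, mem_inter_iff, hxE, hx2, and_true]
      rw [hgx, ((hf.differentiable one_ne_zero) x).lineDeriv_eq_fderiv, mul_comm]
    · intro x hx
      have : x ∉ tsupport (fderiv ℝ f) := fun h => hx (hfs (tsupport_fderiv_subset ℝ h))
      rw [((hf.differentiable one_ne_zero) x).lineDeriv_eq_fderiv,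
        image_eq_zero_of_notMem_tsupport this]
      simp
  rw [← heq]
  refine le_of_tendsto hlim ?_
  filter_upwards [Ioo_mem_nhdsGT (lt_min ht₀ one_pos)] with t ht
  have ht0 : 0 < t := ht.1
  have htt₀ : t < t₀ := ht.2.trans_le (min_le_left _ _)
  have ht1 : t < 1 := ht.2.trans_le (min_le_right _ _)
  have hA := measurableSet_gain hE (t • v)
  have hB := measurableSet_gain hE.compl (t • v)
  have hprod : ∀ w, Integrable (fun x => f (x + w) * g x) volume := fun w =>
    hgint.bdd_mul (c := 1) (hf.continuous.comp (continuous_add_const w)).aestronglyMeasurable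
      (Eventually.of_forall fun x => hf1 _)
  -- Discrete integration by parts: the translation passes from `f` to `g`, whose increments on
  -- `B_1` are controlled by the two gains.
  have hshift : ∫ x, f (x + t • v) * g x = ∫ x, f x * g (x - t • v) := by
    rw [← integral_add_right_eq_self (fun x => f x * g (x - t • v)) (t • v)]
    simp
  have hprod' : Integrable (fun x => f x * g (x - t • v)) volume := by
    simpa using (hprod (t • v)).comp_sub_right (t • v)
  have hprod0 : Integrable (fun x => f x * g x) volume := by simpa using hprod 0
  have hAint : Integrable ((gain E (t • v)).indicator fun _ => (1 : ℝ)) volume :=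
    (integrable_indicator_iff hA).2 (integrableOn_const (volume_gain_lt_top _ _).ne)
  have hBint : Integrable ((gain Eᶜ (t • v)).indicator fun _ => (1 : ℝ)) volume :=
    (integrable_indicator_iff hB).2 (integrableOn_const (volume_gain_lt_top _ _).ne)
  have hpt : ∀ x, f x * g (x - t • v) - f x * g x ≤
      (gain E (t • v)).indicator (fun _ => (1 : ℝ)) x +
        (gain Eᶜ (t • v)).indicator (fun _ => (1 : ℝ)) x := by
    intro x
    by_cases hx : x ∈ ball (0 : Space n) 1
    · have hx2 : x ∈ ball (0 : Space n) 2 := ball_subset_ball one_le_two hx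
      have hxt : x - t • v ∈ ball (0 : Space n) 2 := by
        rw [mem_ball_zero_iff] at hx ⊢
        have h1 := norm_sub_le x (t • v)
        rw [norm_smul, hv, mul_one, Real.norm_of_nonneg ht0.le] at h1
        linarith
      have h1 := abs_le.1 (hf1 x)
      by_cases a : x ∈ E <;> by_cases b : x - t • v ∈ E <;>
        simp only [hg, gain, indicator, mem_inter_iff, mem_ofPred_eq, mem_compl_iff, hx, hx2,
          hxt, a, b, and_true, and_false, not_true_eq_false, not_false_eq_true, and_self,
          if_true, if_false] <;> linarith
    · rw [hf0 x hx]
      simp only [zero_mul, sub_zero]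
      exact add_nonneg (indicator_nonneg (fun _ _ => zero_le_one) _)
        (indicator_nonneg (fun _ _ => zero_le_one) _)
  calc ∫ x, (t⁻¹ • (f (x + t • v) - f x)) * g x
      = t⁻¹ * ∫ x, (f x * g (x - t • v) - f x * g x) := by
        rw [integral_sub hprod' hprod0, ← hshift, ← integral_sub (hprod _) hprod0,
          ← integral_const_mul]
        refine integral_congr_ae (Eventually.of_forall fun x => ?_)
        simp only [smul_eq_mul]; ring
    _ ≤ t⁻¹ * ∫ x, ((gain E (t • v)).indicator (fun _ => (1 : ℝ)) x +
        (gain Eᶜ (t • v)).indicator (fun _ => (1 : ℝ)) x) := by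
        refine mul_le_mul_of_nonneg_left ?_ (by positivity)
        exact integral_mono (hprod'.sub hprod0) (hAint.add hBint) hpt
    _ = t⁻¹ * (volume.real (gain E (t • v)) + volume.real (gain Eᶜ (t • v))) := by
        rw [integral_add hAint hBint, integral_indicator_const _ hA, integral_indicator_const _ hB]
        simp
    _ ≤ t⁻¹ * (t * M) := by
        gcongr
        exact hM t ht0 htt₀
    _ = M := by field_simp

/-- Directional bounds on the derivative of the characteristic function bound the perimeter. -/
theorem classicalPerimeter_le_of_directional {M : ℝ}
    (hE : MeasurableSet E)
    (hM : ∀ v : Space n, ‖v‖ = 1 → ∀ f : Space n → ℝ, ContDiff ℝ 1 f → HasCompactSupport f →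
      tsupport f ⊆ ball 0 1 → (∀ x, |f x| ≤ 1) →
      ∫ x in ball 0 1, E.indicator (fun _ => (1 : ℝ)) x * fderiv ℝ f x v ≤ M) :
    classicalPerimeter (ball 0 1) E ≤ ENNReal.ofReal (n * M) := by
  unfold classicalPerimeter totalVariation
  refine iSup_le fun ψ => iSup_le fun hψ => iSup_le fun hψc => iSup_le fun hψs => iSup_le
    fun hψ1 => ENNReal.ofReal_le_ofReal ?_
  let f : Fin n → Space n → ℝ := fun i x => ψ x i
  have hfd : ∀ i, ContDiff ℝ 1 (f i) := fun i =>
    (EuclideanSpace.proj (𝕜 := ℝ) i).contDiff.comp hψ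
  have hsupp : ∀ i, Function.support (f i) ⊆ Function.support ψ := by
    intro i x hx hx'
    exact hx (by simp [f, hx'])
  have hfts : ∀ i, tsupport (f i) ⊆ tsupport ψ := fun i => closure_mono (hsupp i)
  have hfc : ∀ i, HasCompactSupport (f i) := fun i => hψc.mono (hsupp i)
  have hder : ∀ x i, fderiv ℝ ψ x (EuclideanSpace.single i 1) i =
      fderiv ℝ (f i) x (EuclideanSpace.single i 1) := by
    intro x i
    have h := (EuclideanSpace.proj (𝕜 := ℝ) i).hasFDerivAt.comp x
      ((hψ.differentiable one_ne_zero) x).hasFDerivAt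
    have h' : fderiv ℝ (f i) x = (EuclideanSpace.proj (𝕜 := ℝ) i).comp (fderiv ℝ ψ x) :=
      h.fderiv
    rw [h']
    rfl
  have hint : ∀ i, Integrable (fun x => E.indicator (fun _ => (1 : ℝ)) x *
      fderiv ℝ (f i) x (EuclideanSpace.single i 1)) (volume.restrict (ball 0 1)) := by
    intro i
    have h1 : Continuous fun x => fderiv ℝ (f i) x (EuclideanSpace.single i 1) :=
      ((hfd i).continuous_fderiv one_ne_zero).clm_apply continuous_const
    have h2 : HasCompactSupport fun x => fderiv ℝ (f i) x (EuclideanSpace.single i 1) :=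
      (hfc i).fderiv_apply ℝ _
    refine (Integrable.bdd_mul (c := 1) (h1.integrable_of_hasCompactSupport h2)
      (measurable_const.indicator hE).aestronglyMeasurable
      (Filter.Eventually.of_forall fun x => ?_)).restrict
    by_cases hx : x ∈ E <;> simp [hx]
  calc ∫ x in ball 0 1, E.indicator (fun _ => (1 : ℝ)) x * divergence ψ x
      = ∑ i : Fin n, ∫ x in ball 0 1, E.indicator (fun _ => (1 : ℝ)) x *
          fderiv ℝ (f i) x (EuclideanSpace.single i 1) := by
        rw [← integral_finsetSum _ fun i _ => hint i]
        simp only [divergence, Finset.mul_sum, hder]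
    _ ≤ ∑ _i : Fin n, M := Finset.sum_le_sum fun i _ =>
        hM _ (by simp) (f i) (hfd i) (hfc i) ((hfts i).trans hψs) fun x => by
          have := (PiLp.norm_apply_le (ψ x) i).trans (hψ1 x)
          rwa [Real.norm_eq_abs] at this
    _ = n * M := by simp

end

/-! ### Measurable representatives and absorption of the constants -/

section

variable {n : ℕ} {K Kstar : Space n → ℝ} {C₁ R₀ : ℝ} {φ : Space n → ℝ} {v : Space n} {t : ℝ}
  {L : NNReal} {Ω E F : Set (Space n)}

theorem interaction_congr_ae {A A' B B' : Set (Space n)} (hA : A =ᵐ[volume] A')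
    (hB : B =ᵐ[volume] B') : interaction K A B = interaction K A' B' := by
  unfold interaction
  rw [Measure.restrict_congr_set hA, Measure.restrict_congr_set hB]

theorem perimeterIn_congr_ae (h : E =ᵐ[volume] F) :
    perimeterIn K Ω E = perimeterIn K Ω F := by
  unfold perimeterIn
  have hΩ : Ω =ᵐ[volume] Ω := Filter.EventuallyEq.rfl
  rw [interaction_congr_ae (h.inter hΩ) (h.compl.inter hΩ),
    interaction_congr_ae (h.inter hΩ) (h.compl.diff hΩ),
    interaction_congr_ae (h.diff hΩ) (h.compl.inter hΩ)]

theorem classicalPerimeter_congr_ae (h : E =ᵐ[volume] F) :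
    classicalPerimeter Ω E = classicalPerimeter Ω F := by
  unfold classicalPerimeter totalVariation
  have key : ∀ ψ : Space n → Space n,
      ∫ x in Ω, E.indicator (fun _ => (1 : ℝ)) x * divergence ψ x =
        ∫ x in Ω, F.indicator (fun _ => (1 : ℝ)) x * divergence ψ x := fun ψ => by
    refine integral_congr_ae ?_
    filter_upwards [ae_restrict_of_ae (indicator_ae_eq_of_ae_eq_set (f := fun _ => (1 : ℝ)) h)]
      with x hx
    rw [hx]
  simp_rw [key]

/-- A competitor `G` for `F` need not agree with `E` outside `Ω`, only almost everywhere; `(G ∩ Ω) ∪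
(E \ Ω)` does agree and has the same perimeter. -/
theorem IsMinimizer.congr_ae (hE : IsMinimizer K Ω E) (hΩ : MeasurableSet Ω)
    (h : E =ᵐ[volume] F) : IsMinimizer K Ω F where
  measurable := hE.measurable.congr h
  finite := perimeterIn_congr_ae (K := K) (Ω := Ω) h ▸ hE.finite
  le G hG hGF := by
    have hdiff : (G ∩ Ω ∪ E \ Ω) \ Ω = E \ Ω := by
      ext x; simp only [mem_sdiff, mem_union, mem_inter_iff]; tauto
    have hae : (G ∩ Ω ∪ E \ Ω : Set (Space n)) =ᵐ[volume] G := by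
      have h1 : (G ∩ Ω ∪ E \ Ω : Set (Space n)) =ᵐ[volume] (G ∩ Ω ∪ F \ Ω : Set (Space n)) :=
        Filter.EventuallyEq.rfl.union (h.diff Filter.EventuallyEq.rfl)
      rwa [← hGF, inter_union_sdiff] at h1
    rw [← perimeterIn_congr_ae h, ← perimeterIn_congr_ae hae]
    exact hE.le _ ((hG.inter hΩ.nullMeasurableSet).union
      (hE.measurable.diff hΩ.nullMeasurableSet)) hdiff

theorem IsMinimizer.perimeterIn_le_perimeter (hE : IsMinimizer K Ω E) (hΩ : MeasurableSet Ω) :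
    perimeterIn K Ω E ≤ perimeter K Ω :=
  (hE.le _ (hE.measurable.union hΩ.nullMeasurableSet) union_sdiff_right).trans
    (KPer.perimeterIn_le_perimeter Ω E)

/-- The rate at which a minimizer changes, in measure, under small translations. -/
theorem IsAdmissible.volume_gain_add_le (hK : IsAdmissible K (controlKernel K C₁ R₀))
    (hn : 1 ≤ n) (hC : 0 ≤ C₁) (hφ : LipschitzWith L φ) (hd : ContDiff ℝ 1 φ)
    (hφ1 : ∀ x ∈ ball (0 : Space n) 2, φ x = 1) (hφ0 : ∀ x ∉ ball (0 : Space n) 4, φ x = 0)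
    (hE : MeasurableSet E) (hmin : IsMinimizer K (ball 0 4) E) (hv : ‖v‖ = 1) (ht0 : 0 < t)
    (ht1 : t ≤ 1) (htL : t * L ≤ 1 / 2) :
    volume.real (gain E (t • v)) + volume.real (gain Eᶜ (t • v)) ≤
      t * (2 * √(L ^ 2 * (11 * C₁ + 2) * (perimeter K (ball 0 4)).toReal +
          L ^ 2 * (11 * C₁) * volume.real (ball (0 : Space n) (4 + R₀)) ^ 2) +
        volume.real (ball (0 : Space n) 1) * n) := by
  set p := (perimeter K (ball 0 4)).toReal with hp
  set N := volume.real (ball (0 : Space n) (4 + R₀)) with hN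
  set η := L ^ 2 * (11 * C₁ + 2) * p + L ^ 2 * (11 * C₁) * N ^ 2 with hη
  have hp0 : 0 ≤ p := ENNReal.toReal_nonneg
  have hη0 : 0 ≤ η := by positivity
  have htabs : |t| = t := abs_of_pos ht0
  have hperim : perimeter K (ball 0 4) = ENNReal.ofReal p :=
    (ENNReal.ofReal_toReal (hK.perimeter_ball_lt_top hn (by norm_num)).ne).symm
  have hNeq : volume (ball (0 : Space n) (4 + R₀)) = ENNReal.ofReal N :=
    (ENNReal.ofReal_toReal measure_ball_lt_top.ne).symm
  have hint := hK.interaction_deform_le hC hφ hd hv (by rwa [htabs]) measurableSet_ball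
    Subset.rfl hφ0 hE hmin
  have hprod := (hK.volume_gain_mul_le hφ hv (by rwa [htabs]) hφ1 (by rwa [htabs]) hE).trans hint
  have hle : volume (gain E (t • v)) * volume (gain Eᶜ (t • v)) ≤ ENNReal.ofReal (t ^ 2 * η) := by
    refine hprod.trans ?_
    rw [hη, ENNReal.ofReal_mul (sq_nonneg t), ENNReal.ofReal_add (by positivity) (by positivity),
      ENNReal.ofReal_mul (q := p) (by positivity), ENNReal.ofReal_mul (q := N ^ 2) (by positivity),
      ENNReal.ofReal_pow (p := N) (by positivity), ← hNeq, ← hperim]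
    gcongr
    exact hmin.perimeterIn_le_perimeter measurableSet_ball
  have hreal : volume.real (gain E (t • v)) * volume.real (gain Eᶜ (t • v)) ≤ (t * √η) ^ 2 := by
    rw [mul_pow, Real.sq_sqrt hη0, Measure.real, Measure.real, ← ENNReal.toReal_mul]
    exact ENNReal.toReal_le_of_le_ofReal (by positivity) hle
  have hgain : ∀ F : Set (Space n), MeasurableSet F → volume.real (gain F (t • v)) ≤
      volume.real (gain Fᶜ (t • v)) + t * (volume.real (ball (0 : Space n) 1) * n) := by
    intro F hF
    have h := volume_gain_le hn hF (t • v)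
    have hfin := (volume_gain_lt_top Fᶜ (t • v)).ne
    have hfin2 : volume (ball (0 : Space n) 1) * ENNReal.ofReal (n * ‖t • v‖) ≠ ∞ :=
      ENNReal.mul_ne_top measure_ball_lt_top.ne ENNReal.ofReal_ne_top
    have h' := ENNReal.toReal_mono (ENNReal.add_ne_top.2 ⟨hfin, hfin2⟩) h
    rw [ENNReal.toReal_add hfin hfin2, ENNReal.toReal_mul, ENNReal.toReal_ofReal (by positivity),
      norm_smul, hv, mul_one, Real.norm_of_nonneg ht0.le] at h'
    refine h'.trans_eq ?_
    simp only [Measure.real]; ring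
  have hba := hgain Eᶜ hE.compl
  rw [compl_compl] at hba
  have := add_le_of_mul_le_sq measureReal_nonneg measureReal_nonneg (by positivity) hreal
    (hgain E hE) hba
  refine this.trans_eq ?_
  ring

theorem IsAdmissible.classicalPerimeter_le (hK : IsAdmissible K (controlKernel K C₁ R₀))
    (hn : 1 ≤ n) (hC : 0 ≤ C₁) (hφ : LipschitzWith L φ) (hd : ContDiff ℝ 1 φ)
    (hφ1 : ∀ x ∈ ball (0 : Space n) 2, φ x = 1) (hφ0 : ∀ x ∉ ball (0 : Space n) 4, φ x = 0)
    (hmin : IsMinimizer K (ball 0 4) E) :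
    classicalPerimeter (ball 0 1) E ≤ ENNReal.ofReal
      (n * (2 * √(L ^ 2 * (11 * C₁ + 2) * (perimeter K (ball 0 4)).toReal +
          L ^ 2 * (11 * C₁) * volume.real (ball (0 : Space n) (4 + R₀)) ^ 2) +
        volume.real (ball (0 : Space n) 1) * n)) := by
  obtain ⟨F, -, hF, hFE⟩ := hmin.measurable.exists_measurable_superset_ae_eq
  have hminF := hmin.congr_ae measurableSet_ball hFE.symm
  rw [← classicalPerimeter_congr_ae hFE]
  refine classicalPerimeter_le_of_directional hF fun v hv f hf hfc hfs hf1 => ?_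
  have hL : (0 : ℝ) < 2 * (L + 1) := by positivity
  -- This `t₀` ensures both `t ≤ 1`, so translates of `B_1` stay in `B_2`, and `t L ≤ 1/2`.
  refine setIntegral_indicator_mul_fderiv_le hF hv (t₀ := min 1 (1 / (2 * (L + 1))))
    (by positivity) (fun t ht0 ht => ?_) hf hfc hfs hf1
  refine hK.volume_gain_add_le hn hC hφ hd hφ1 hφ0 hF hminF hv ht0
    (ht.trans_le (min_le_left _ _)).le ?_
  have h2 := (ht.trans_le (min_le_right _ _)).le
  rw [le_div_iff₀ hL] at h2
  linarith

theorem exists_lipschitz_cutoff (n : ℕ) : ∃ (φ : Space n → ℝ) (L : NNReal), LipschitzWith L φ ∧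
    ContDiff ℝ 1 φ ∧ (∀ x ∈ ball (0 : Space n) 2, φ x = 1) ∧ ∀ x ∉ ball (0 : Space n) 4, φ x = 0 := by
  let f : ContDiffBump (0 : Space n) := ⟨2, 3, by norm_num, by norm_num⟩
  have hf : ContDiff ℝ 1 f := f.contDiff
  obtain ⟨L, hL⟩ := hf.lipschitzWith_of_hasCompactSupport f.hasCompactSupport one_ne_zero
  refine ⟨f, L, hL, hf, fun x hx => f.one_of_mem_closedBall (ball_subset_closedBall hx),
    fun x hx => f.zero_of_le_dist ?_⟩
  rw [mem_ball, not_lt] at hx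
  exact le_trans (by norm_num [f]) hx

/-- The lower bounds on `c` and `p` turn every lower-order term into a multiple of `c p` or `√(c
p)`: `2 ≤ (2/c₀) c`, `N ≤ (N/p₀) p`, `V ≤ V √(c p) / √(c₀ p₀)`. The added `1` makes the constant
visibly positive. -/
theorem sqrt_remainder_le {a c c₀ p p₀ N V m : ℝ} (ha : 0 ≤ a) (hc₀ : 0 < c₀) (hp₀ : 0 < p₀)
    (hc : c₀ ≤ c) (hp : p₀ ≤ p) (hN : 0 ≤ N) (hV : 0 ≤ V) (hm : 0 ≤ m) :
    m * (2 * √(a * (11 * c + 2) * p + a * (11 * c) * N) + V) ≤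
      (m * (2 * √(a * (11 + 2 / c₀ + 11 * N / p₀)) + V / √(c₀ * p₀)) + 1) * √(c * p) := by
  have hc' : 0 < c := hc₀.trans_le hc
  have hp' : 0 < p := hp₀.trans_le hp
  have h1 : √(a * (11 * c + 2) * p + a * (11 * c) * N) ≤
      √(a * (11 + 2 / c₀ + 11 * N / p₀)) * √(c * p) := by
    rw [← Real.sqrt_mul (by positivity)]
    refine Real.sqrt_le_sqrt ?_
    have e1 : 2 ≤ 2 / c₀ * c := by
      rw [div_mul_eq_mul_div, le_div_iff₀ hc₀]; linarith
    have e2 : N ≤ N / p₀ * p := by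
      rw [div_mul_eq_mul_div, le_div_iff₀ hp₀]
      exact mul_le_mul_of_nonneg_left hp hN
    calc a * (11 * c + 2) * p + a * (11 * c) * N
        ≤ a * (11 * c + 2 / c₀ * c) * p + a * (11 * c) * (N / p₀ * p) := by gcongr
      _ = _ := by ring
  have h2 : V ≤ V / √(c₀ * p₀) * √(c * p) := by
    rw [div_mul_eq_mul_div, le_div_iff₀ (by positivity)]
    gcongr
  calc m * (2 * √(a * (11 * c + 2) * p + a * (11 * c) * N) + V)
      ≤ m * (2 * (√(a * (11 + 2 / c₀ + 11 * N / p₀)) * √(c * p)) +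
          V / √(c₀ * p₀) * √(c * p)) := by gcongr
    _ = m * (2 * √(a * (11 + 2 / c₀ + 11 * N / p₀)) + V / √(c₀ * p₀)) * √(c * p) := by ring
    _ ≤ _ := by gcongr; linarith

end

end KPer

theorem mainTheorem8 (n : ℕ) (hn : 1 ≤ n) (R₀ : ℝ) (hR₀ : 2 ≤ R₀) :
    ∃ C : ℝ, 0 < C ∧
      ∀ (K : KPer.Space n → ℝ) (C₁ : ℝ),
        KPer.IsAdmissible K (KPer.controlKernel K C₁ R₀) →
        ∀ E : Set (KPer.Space n), KPer.IsMinimizer K (ball 0 4) E →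
          KPer.perimeter K (ball 0 4) < ∞ ∧
          KPer.classicalPerimeter (ball 0 1) E ≤
            ENNReal.ofReal (C * √(C₁ * (KPer.perimeter K (ball 0 4)).toReal)) := by
  obtain ⟨c₀, hc₀, hlow⟩ := KPer.exists_constant_lower_bound n hn R₀ hR₀
  obtain ⟨φ, L, hφ, hd, hφ1, hφ0⟩ := KPer.exists_lipschitz_cutoff n
  set p₀ := volume.real (ball (0 : KPer.Space n) (1 / 2)) *
    volume.real (ball (0 : KPer.Space n) (1 / 2)) with hp₀
  have hball : 0 < volume.real (ball (0 : KPer.Space n) (1 / 2)) :=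
    ENNReal.toReal_pos (measure_ball_pos _ _ (by norm_num)).ne' measure_ball_lt_top.ne
  have hp₀pos : 0 < p₀ := mul_pos hball hball
  refine ⟨n * (2 * √(L ^ 2 * (11 + 2 / c₀ +
      11 * volume.real (ball (0 : KPer.Space n) (4 + R₀)) ^ 2 / p₀)) +
    -- The constant of `sqrt_remainder_le`, with `a = L²`, `N = |B_{4+R₀}|²`, `V = n |B_1|` and `m =
    -- n`. The cutoff, `c₀` and `p₀` are fixed before `K`, so it depends only on `n` and `R₀`.
    volume.real (ball (0 : KPer.Space n) 1) * n / √(c₀ * p₀)) + 1, by positivity,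
    fun K C₁ hK E hE => ?_⟩
  have hfin : KPer.perimeter K (ball 0 4) < ∞ := hK.perimeter_ball_lt_top hn (by norm_num)
  have hC := hlow K C₁ hK
  have hp : p₀ ≤ (KPer.perimeter K (ball 0 4)).toReal := by
    rw [hp₀, Measure.real, ← ENNReal.toReal_mul]
    exact ENNReal.toReal_mono hfin.ne (hK.volume_sq_le_perimeter hn)
  exact ⟨hfin, (hK.classicalPerimeter_le hn (hc₀.le.trans hC) hφ hd hφ1 hφ0 hE).trans
    (ENNReal.ofReal_le_ofReal (KPer.sqrt_remainder_le (by positivity) hc₀ hp₀pos hC hp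
      (by positivity) (by positivity) n.cast_nonneg))⟩
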